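/- **Setting.** Let $n,t\ge 0$ be integers with $3t<n$. There are $n$ asynchronous sequential processes $p_1,\dots,p_n$ with binary proposals $v_i\in\{0,1\}$, connected by a reliable point-to-point network. Up to $t$ processes may be *faulty* (Byzantine), i.e. behave arbitrarily and in collusion; the others are *non-faulty* and follow the code below. An adversary controls the faulty processes, may choose adaptively which processes (at most $t$) become faulty, and schedules all events: it sees all local states and messages so far, and at each time it chooses the next event (a step of a process, the reception or the handling of a message, the corruption of a process, the sending of a message by a faulty process, a hash evaluation). Cryptography is idealized: * *Signatures.* A faulty process can use signatures of faulty processes, and signatures that other processes have already made while following their code, and no others. $\langle m\rangle_i$ denotes $m$ signed by $p_i$. * *Threshold signatures.* Signatures of the same message $m$ by $n-t$ different processes can be combined into the $(n-t)$-threshold signature of $m$, which depends only on $m$ and cannot be obtained from fewer signatures. * *Random oracle.* A hash function maps every bit string and every threshold signature to a bit string of a fixed positive length; the outputs are independent and uniformly distributed. The faulty processes can evaluate it on any bit string, and on the threshold signature of $m$ as soon as signatures of $m$ by $n-t$ different processes are available (counting all faulty processes). **Algorithm** (code of $p_i$). The process keeps a round number $r_i$, an estimate $est_i\in\{0,1,\bot\}$,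 a map $coin_i$ from rounds to bits, and a set $A_i$ of signed messages $\langle\mathrm{AUX}(r,v)\rangle_j$. "$k$ messages of a kind" always means: from $k$ different signers. 1. Start with $r_i=0$, $A_i=\emptyset$, $coin_i$ empty; broadcast $\langle\mathrm{AUX}(0,v_i)\rangle_i$ with the empty proof set. Wait until $A_i$ contains $n-t$ messages of round $0$. Set $est_i:=0$ if $A_i$ contains $t+1$ messages $\mathrm{AUX}(0,0)$, and $est_i:=1$ otherwise. 2. Repeat forever: (a) $r_i:=r_i+1$; choose a set $P\subseteq A_i$ such that $\mathrm{is\_valid}(r_i,est_i,P)$; broadcast $\langle\mathrm{AUX}(r_i,est_i)\rangle_i$ together with the proof set $P$. (b) Wait until $A_i$ contains $n-t$ messages of round $r_i$ (of either value). If for some $b\in\{0,1\}$ it contains $n-t$ messages $\mathrm{AUX}(r_i,b)$, set $est_i:=b$, else $est_i:=\bot$. (c) Broadcast $\langle\mathrm{COIN}(r_i)\rangle_i$; wait until $n-t$ messages $\mathrm{COIN}(r_i)$ have been received; let $coin_i[r_i]$ be the first bit of the hash of the threshold signature of $\mathrm{COIN}(r_i)$. (d) If $A_i$ contains $n-t$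 messages $\mathrm{AUX}(r_i,coin_i[r_i])$, decide $coin_i[r_i]$ unless $p_i$ has already decided. If $est_i=\bot$, set $est_i:=coin_i[r_i]$. *Reception handler.* A received message $\langle\mathrm{AUX}(r,v)\rangle_j$ with proof set $P$ is handled once $p_i$ has started and knows $coin_i[q]$ for all $1\le q<r$; until then it is kept. If $\mathrm{is\_valid}(r,v,P)$ holds, then all messages not needed to satisfy the predicate are removed from $P$ (leaving a valid subset from which no message can be removed), and $\langle\mathrm{AUX}(r,v)\rangle_j$ and the remaining set are added to $A_i$. Otherwise the message is discarded. *The predicate* $\mathrm{is\_valid}(r,v,P)$ at $p_i$: it is true for $r=0$. For $r=1$ it is true iff $P$ contains $t+1$ messages $\mathrm{AUX}(0,v)$. For $r\ge 2$, let $q$ be the largest round with $1\le q<r$ and $coin_i[q]=\neg v$, or $q=0$ if there is none; the predicate is true iff $q=0$ and $P$ contains $t+1$ messages $\mathrm{AUX}(0,v)$, or $P$ contains $n-t$ messages $\mathrm{AUX}(q,v)$. **Theorem.** The algorithm solves binary Byzantine consensus when $t<n/3$. Precisely, for all proposals and every adversary: * *BBC-Agreement.* In every execution, no two non-faulty processes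 decide different values. * *BBC-Validity.* In every execution, if all non-faulty processes propose the same value, then no non-faulty process decides another value. * *BBC-Termination.* With probability $1$ over the random oracle, if the execution has finite delays (for non-faulty processes, every message sent to them is eventually received, every received message that can be handled is eventually handled, and the main code eventually makes a step whenever it is not waiting), then every non-faulty process eventually decides. -/

import Mathlib

open MeasureTheory

namespace BBC

/-! ### Messages, signatures, random oracle -/

/-- The plain contents that processes sign. -/
inductive Content where
  | aux (r : ℕ) (v : Bool)
  | coin (r : ℕ)
  deriving DecidableEq

/-- A content signed by process `signer`. -/
structure Signed (n : ℕ) where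
  signer : Fin n
  content : Content
  deriving DecidableEq

/-- An `AUX(round, value)` message signed by process `signer`. -/
structure SignedAux (n : ℕ) where
  signer : Fin n
  round : ℕ
  value : Bool
  deriving DecidableEq

/-- A `COIN(round)` message signed by process `signer`. -/
structure SignedCoin (n : ℕ) where
  signer : Fin n
  round : ℕ
  deriving DecidableEq

def SignedAux.toSigned {n : ℕ} (a : SignedAux n) : Signed n := ⟨a.signer, .aux a.round a.value⟩

def SignedCoin.toSigned {n : ℕ} (a : SignedCoin n) : Signed n := ⟨a.signer, .coin a.round⟩

/-- Network messages: a signed `AUX` message together with a set of signed `AUX` messages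
(its proofs), or a signed `COIN` message. -/
inductive Msg (n : ℕ) where
  | auxProof (a : SignedAux n) (proofs : Finset (SignedAux n))
  | coin (a : SignedCoin n)
  deriving DecidableEq

/-- All signatures that occur in a network message. -/
def Msg.signatures {n : ℕ} : Msg n → Finset (Signed n)
  | .auxProof a proofs => insert a.toSigned (proofs.image SignedAux.toSigned)
  | .coin a => {a.toSigned}

/-- Inputs of the hash function: the threshold signature of a content (it is unique, hence
determined by the content alone) or any other string of bits. -/
inductive OracleInput where
  | thresholdSig (c : Content)
  | bits (x : List Bool)
  deriving DecidableEq

/-- Outputs of the hash function: bit strings of a fixed positive length `ℓ + 1`. -/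
abbrev Hash (ℓ : ℕ) : Type := Fin (ℓ + 1) → Bool

/-- A (realization of the) hash function. -/
abbrev Oracle (ℓ : ℕ) : Type := OracleInput → Hash ℓ

/-- The law of the random oracle: independent uniformly distributed outputs. -/
noncomputable def oracleLaw (ℓ : ℕ) : Measure (Oracle ℓ) :=
  Measure.infinitePi fun _ : OracleInput => (PMF.uniformOfFintype (Hash ℓ)).toMeasure

/-- The coin of round `r`: first bit of the hash of the threshold signature of `COIN(r)`. -/
def coinOf {ℓ : ℕ} (H : Oracle ℓ) (r : ℕ) : Bool := H (.thresholdSig (.coin r)) 0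

/-! ### Counting messages from different processes -/

/-- The processes whose signed `AUX(r, v)` is in `A`. -/
def auxSigners {n : ℕ} (A : Finset (SignedAux n)) (r : ℕ) (v : Bool) : Finset (Fin n) :=
  Finset.univ.filter fun i => ⟨i, r, v⟩ ∈ A

/-- The processes that have a signed `AUX` message of round `r`, of either value, in `A`. -/
def roundSigners {n : ℕ} (A : Finset (SignedAux n)) (r : ℕ) : Finset (Fin n) :=
  Finset.univ.filter fun i => ∃ v : Bool, ⟨i, r, v⟩ ∈ A

/-- The processes whose signed `COIN(r)` is in `C`. -/
def coinSigners {n : ℕ} (C : Finset (SignedCoin n)) (r : ℕ) : Finset (Fin n) :=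
  Finset.univ.filter fun i => ⟨i, r⟩ ∈ C

/-! ### The predicate `is_valid` -/

/-- A finite map from rounds to coin values, as an association list. -/
abbrev CoinMap : Type := List (ℕ × Bool)

/-- The largest round smaller than `r` whose coin is known to be `¬ est`, or `0` if there is
none. -/
def prevRound (cm : CoinMap) (r : ℕ) (est : Bool) : ℕ :=
  Nat.findGreatest (fun s => cm.lookup s = some (!est)) (r - 1)

/-- The predicate `is_valid(r, est, proofs)`, evaluated with the coin map `cm`. -/
def isValid (n t : ℕ) (cm : CoinMap) (r : ℕ) (est : Bool) (proofs : Finset (SignedAux n)) :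
    Bool :=
  if r = 0 then true
  else if r = 1 then decide (t + 1 ≤ (auxSigners proofs 0 est).card)
  else if prevRound cm r est = 0 ∧ t + 1 ≤ (auxSigners proofs 0 est).card then true
  else decide (n - t ≤ (auxSigners proofs (prevRound cm r est) est).card)

/-- `Q` is what remains of `proofs` once the messages not needed to satisfy `is_valid` are
removed: a valid subset from which no message can be removed. -/
def IsTrimmed (n t : ℕ) (cm : CoinMap) (r : ℕ) (est : Bool) (proofs Q : Finset (SignedAux n)) :
    Prop :=
  Q ⊆ proofs ∧ isValid n t cm r est Q = true ∧
    ∀ a ∈ Q, isValid n t cm r est (Q.erase a) = false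

instance (n t : ℕ) (cm : CoinMap) (r : ℕ) (est : Bool) (proofs Q : Finset (SignedAux n)) :
    Decidable (IsTrimmed n t cm r est proofs Q) := by
  unfold IsTrimmed; infer_instance

/-! ### The code of a process -/

/-- Control points of the main thread. -/
inductive PC where
  /-- before initialization and the broadcast of the proposal -/
  | start
  /-- waiting for `n - t` round `0` messages, then choosing the first estimate -/
  | waitProposals
  /-- top of the loop: next round, computing the proofs and broadcasting `AUX` -/
  | roundStart
  /-- waiting for `n - t` `AUX` messages of the round, then updating the estimate -/
  | waitAux
  /-- broadcasting `COIN` -/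
  | sendCoin
  /-- waiting for `n - t` `COIN` messages of the round, then computing the coin -/
  | waitCoin
  /-- end of the loop: possibly deciding, and resolving the estimate -/
  | finish
  deriving DecidableEq

/-- Local state of a process. The estimate `none` is the special value `C_VAL`; `coins` holds
the received `COIN` messages, `inbox` the received `AUX_PROOF` messages that the reception
handler has not processed yet. -/
structure Local (n : ℕ) where
  pc : PC
  round : ℕ
  est : Option Bool
  coinMap : CoinMap
  auxValues : Finset (SignedAux n)
  coins : Finset (SignedCoin n)
  inbox : Finset (SignedAux n × Finset (SignedAux n))
  decision : Option Bool

def Local.initial (n : ℕ) : Local n where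
  pc := .start
  round := 0
  est := none
  coinMap := []
  auxValues := ∅
  coins := ∅
  inbox := ∅
  decision := none

/-- One step of the main thread of process `i` with proposal `v`: the new local state and the
message that is broadcast, if any; `none` if the thread is blocked. `P` is the set of proofs the
process picks if it is at the top of the loop; it is irrelevant at other control points. -/
def mainStep {n ℓ : ℕ} (t : ℕ) (H : Oracle ℓ) (i : Fin n) (v : Bool) (P : Finset (SignedAux n))
    (s : Local n) : Option (Local n × Option (Msg n)) :=
  match s.pc with
  | .start =>
      some ({ s with pc := .waitProposals, round := 0, auxValues := ∅, coinMap := [] },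
        some (.auxProof ⟨i, 0, v⟩ ∅))
  | .waitProposals =>
      if n - t ≤ (roundSigners s.auxValues s.round).card then
        some ({ s with
          pc := .roundStart
          est := some (if t + 1 ≤ (auxSigners s.auxValues s.round false).card
            then false else true) }, none)
      else none
  | .roundStart =>
      match s.est with
      | none => none
      | some e =>
        if P ⊆ s.auxValues ∧ isValid n t s.coinMap (s.round + 1) e P = true then
          some ({ s with pc := .waitAux, round := s.round + 1 },
            some (.auxProof ⟨i, s.round + 1, e⟩ P))
        else none
  | .waitAux =>
      if n - t ≤ (roundSigners s.auxValues s.round).card then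
        some ({ s with
          pc := .sendCoin
          est := if n - t ≤ (auxSigners s.auxValues s.round false).card then some false
            else if n - t ≤ (auxSigners s.auxValues s.round true).card then some true
            else none }, none)
      else none
  | .sendCoin => some ({ s with pc := .waitCoin }, some (.coin ⟨i, s.round⟩))
  | .waitCoin =>
      if n - t ≤ (coinSigners s.coins s.round).card then
        some ({ s with
          pc := .finish
          coinMap := (s.round, coinOf H s.round) :: s.coinMap }, none)
      else none
  | .finish =>
      match s.coinMap.lookup s.round with
      | none => none
      | some c =>
        some ({ s with
          pc := .roundStart
          decision :=
            if s.decision = none ∧ n - t ≤ (auxSigners s.auxValues s.round c).card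
            then some c else s.decision
          est := some (s.est.getD c) }, none)

/-- The reception handler can be run on an `AUX_PROOF` message of round `r`: the process has
started, and it knows the coins of all rounds smaller than `r`, which `is_valid` inspects. -/
def Local.ready {n : ℕ} (s : Local n) (r : ℕ) : Prop :=
  s.pc ≠ .start ∧ ∀ q ∈ Finset.Ico 1 r, (s.coinMap.lookup q).isSome = true

instance {n : ℕ} (s : Local n) (r : ℕ) : Decidable (s.ready r) := by
  unfold Local.ready; infer_instance

/-- The reception handler on the message `AUX_PROOF(a, proofs)`; `Q` is the part of `proofs` that
is kept. -/
def handleStep {n : ℕ} (t : ℕ) (a : SignedAux n) (proofs Q : Finset (SignedAux n)) (s : Local n) :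
    Local n :=
  if (a, proofs) ∈ s.inbox ∧ s.ready a.round then
    if isValid n t s.coinMap a.round a.value proofs = true then
      if IsTrimmed n t s.coinMap a.round a.value proofs Q then
        { s with
          inbox := s.inbox.erase (a, proofs)
          auxValues := s.auxValues ∪ {a} ∪ Q }
      else s
    else { s with inbox := s.inbox.erase (a, proofs) }
  else s

/-- Reception of a message from the network. -/
def receive {n : ℕ} (m : Msg n) (s : Local n) : Local n :=
  match m with
  | .auxProof a proofs => { s with inbox := insert (a, proofs) s.inbox }
  | .coin a => { s with coins := insert a s.coins }

/-! ### The system -/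

/-- Global configuration. `network` holds the messages in transit with their destinations,
`signed` the signatures made by processes while following their code, `answers` the hash values
that the adversary has asked for. -/
structure Config (n ℓ : ℕ) where
  loc : Fin n → Local n
  faulty : Finset (Fin n)
  network : Finset (Fin n × Msg n)
  signed : Finset (Signed n)
  answers : List (OracleInput × Hash ℓ)

def Config.initial (n ℓ : ℕ) : Config n ℓ where
  loc := fun _ => Local.initial n
  faulty := ∅
  network := ∅
  signed := ∅
  answers := []

/-- The signature can be produced by the faulty processes, or has been made by its owner. -/
def Config.available {n ℓ : ℕ} (C : Config n ℓ) (x : Signed n) : Prop :=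
  x.signer ∈ C.faulty ∨ x ∈ C.signed

instance {n ℓ : ℕ} (C : Config n ℓ) (x : Signed n) : Decidable (C.available x) := by
  unfold Config.available; infer_instance

/-- The hash inputs the adversary can evaluate: threshold signatures of contents for which
signatures of `n - t` different processes are available, and all other strings. -/
def Config.computable {n ℓ : ℕ} (t : ℕ) (C : Config n ℓ) : OracleInput → Prop
  | .thresholdSig c => n - t ≤ (Finset.univ.filter fun i : Fin n => C.available ⟨i, c⟩).card
  | .bits _ => True

instance {n ℓ : ℕ} (t : ℕ) (C : Config n ℓ) (x : OracleInput) : Decidable (C.computable t x) := by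
  cases x <;> unfold Config.computable <;> infer_instance

/-- The events; which one occurs next is up to the adversary. -/
inductive Action (n : ℕ) where
  /-- the main thread of `i` makes a step -/
  | step (i : Fin n) (P : Finset (SignedAux n))
  /-- message `m` in transit to `i` is received -/
  | deliver (i : Fin n) (m : Msg n)
  /-- process `i` runs the reception handler on `AUX_PROOF(a, proofs)` -/
  | handle (i : Fin n) (a : SignedAux n) (proofs Q : Finset (SignedAux n))
  /-- process `i` becomes faulty -/
  | corrupt (i : Fin n)
  /-- the faulty process `i` sends `m` to `j` -/
  | send (i j : Fin n) (m : Msg n)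
  /-- the faulty processes evaluate the hash function -/
  | query (x : OracleInput)
  | idle

def updateLoc {n ℓ : ℕ} (C : Config n ℓ) (i : Fin n) (s : Local n) : Config n ℓ :=
  { C with loc := Function.update C.loc i s }

/-- Process `i`, following its code, signs and broadcasts a message. -/
def broadcast {n ℓ : ℕ} (C : Config n ℓ) : Option (Msg n) → Config n ℓ
  | none => C
  | some m =>
    { C with
      network := C.network ∪ Finset.univ.image fun j : Fin n => (j, m)
      signed := match m with
        | .auxProof a _ => insert a.toSigned C.signed
        | .coin a => insert a.toSigned C.signed }

/-- The effect of an event; an event that is not possible has no effect. -/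
def execute {n ℓ : ℕ} (t : ℕ) (prop : Fin n → Bool) (H : Oracle ℓ) (C : Config n ℓ) :
    Action n → Config n ℓ
  | .step i P =>
      if i ∈ C.faulty then C
      else match mainStep t H i (prop i) P (C.loc i) with
        | none => C
        | some (s, m) => broadcast (updateLoc C i s) m
  | .deliver i m =>
      if (i, m) ∈ C.network then
        { updateLoc C i (receive m (C.loc i)) with network := C.network.erase (i, m) }
      else C
  | .handle i a proofs Q =>
      if i ∈ C.faulty then C
      else updateLoc C i (handleStep t a proofs Q (C.loc i))
  | .corrupt i => if C.faulty.card < t then { C with faulty := insert i C.faulty } else C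
  | .send i j m =>
      if i ∈ C.faulty ∧ ∀ x ∈ m.signatures, C.available x then
        { C with network := insert (j, m) C.network }
      else C
  | .query x =>
      if C.computable t x then { C with answers := (x, H x) :: C.answers } else C
  | .idle => C

/-- The adversary controls the scheduling, the network, and the faulty processes. It chooses
the next event from the sequence of all configurations so far (latest first). -/
abbrev Adversary (n ℓ : ℕ) : Type := List (Config n ℓ) → Action n

/-- The configuration after `k` events, and the list of all earlier ones (latest first). -/
def trace {n ℓ : ℕ} (t : ℕ) (prop : Fin n → Bool) (σ : Adversary n ℓ) (H : Oracle ℓ) :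
    ℕ → Config n ℓ × List (Config n ℓ)
  | 0 => (Config.initial n ℓ, [])
  | k + 1 =>
    let p := trace t prop σ H k
    (execute t prop H p.1 (σ (p.1 :: p.2)), p.1 :: p.2)

/-- The execution: the configuration after `k` events. -/
def run {n ℓ : ℕ} (t : ℕ) (prop : Fin n → Bool) (σ : Adversary n ℓ) (H : Oracle ℓ) (k : ℕ) :
    Config n ℓ :=
  (trace t prop σ H k).1

/-- Process `i` is non-faulty in the execution `ρ`. -/
def NonFaulty {n ℓ : ℕ} (ρ : ℕ → Config n ℓ) (i : Fin n) : Prop :=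
  ∀ k, i ∉ (ρ k).faulty

/-- Process `i` decides `b` in the execution `ρ`. -/
def Decides {n ℓ : ℕ} (ρ : ℕ → Config n ℓ) (i : Fin n) (b : Bool) : Prop :=
  ∃ k, ((ρ k).loc i).decision = some b

/-- Asynchrony with finite delays: for each non-faulty process, every message sent to it is
eventually received, every received `AUX_PROOF` message on which the handler can be run is
eventually handled, and the main thread eventually makes a step whenever it is not blocked. -/
structure FiniteDelays {n ℓ : ℕ} (t : ℕ) (prop : Fin n → Bool) (H : Oracle ℓ)
    (ρ : ℕ → Config n ℓ) : Prop where
  delivery : ∀ i, NonFaulty ρ i → ∀ k m, (i, m) ∈ (ρ k).network →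
    ∃ k' ≥ k, (i, m) ∉ (ρ k').network
  handling : ∀ i, NonFaulty ρ i → ∀ k a proofs, (a, proofs) ∈ ((ρ k).loc i).inbox →
    ((ρ k).loc i).ready a.round → ∃ k' ≥ k, (a, proofs) ∉ ((ρ k').loc i).inbox
  progress : ∀ i, NonFaulty ρ i → ∀ k,
    (∃ P, (mainStep t H i (prop i) P ((ρ k).loc i)).isSome = true) →
    ∃ k' ≥ k, ((ρ k').loc i).pc ≠ ((ρ k).loc i).pc

/-! ### The binary Byzantine consensus problem -/

/-- No two non-faulty processes decide different values. -/
def Agreement {n ℓ : ℕ} (ρ : ℕ → Config n ℓ) : Prop :=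
  ∀ i j b c, NonFaulty ρ i → NonFaulty ρ j → Decides ρ i b → Decides ρ j c → b = c

/-- If all non-faulty processes propose the same value, no other value is decided by a
non-faulty process. -/
def Validity {n ℓ : ℕ} (prop : Fin n → Bool) (ρ : ℕ → Config n ℓ) : Prop :=
  ∀ v, (∀ i, NonFaulty ρ i → prop i = v) → ∀ i b, NonFaulty ρ i → Decides ρ i b → b = v

/-- Every non-faulty process decides. -/
def Termination {n ℓ : ℕ} (ρ : ℕ → Config n ℓ) : Prop :=
  ∀ i, NonFaulty ρ i → ∃ b, Decides ρ i b

end BBC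

/-!
Every message of a round `r ≥ 1` that a process accepts on its own account is *supported*: it comes
with a quorum for its value in the last earlier round whose coin fell on the opposite value, or with
`t + 1` proposals if there is no such round. Only the true coins matter here, since the handler
waits until all coins of earlier rounds are known (`Knows.isValid_iff`). Two sets of `n - t`
signers share a non-faulty process, which signs one value per round, so a round has a quorum for at
most one value (`Inv.eq_of_quorum`).

*Safety.* A decision on `b` in round `r` comes with a quorum for `b` in `r` and with a coin of `r`
equal to `b`. Support for `¬ b` in a later round then needs a quorum for `¬ b` in `r` or in a round
after `r`, and by induction there is none (`Inv.locked`). In the same way support for a value that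
no non-faulty process proposes leads back to `t + 1` proposals of it
(`Inv.not_signed_of_proposals`).

*Progress.* A process always finds support for its estimate in its own set `A`, and everything that
a process sends is acceptable to all others, so with finite delays no non-faulty process is blocked
forever (`exists_le_steps`).

*Termination.* When the coin of round `r` is revealed, at least `t + 1` processes that never
become faulty have finished voting in round `r`, and their estimates other than `⊥` agree. If the
coin falls on this common value (on any prescribed value if all of them have `⊥`), these processes all
enter round `r + 1` with the value of the coin, and the opposite value gets no quorum in round
`r + 1`. If the coin of round `r + 1` is the same, the opposite value has no support in round
`r + 2`, and if that coin is the same too, everybody decides (`termination_of_favored`). The value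
on which the coin of round `r` should fall is fixed before this coin is revealed, and coins are
revealed in order, so it is a function of the hashes other than the coins of rounds from `r` on
(`favored_congr`). Therefore each of the triples of rounds `1, 4, 7, …` succeeds with a probability
bounded below, independently of the past, and almost surely one of them does
(`ae_exists_luckySet`).
-/

namespace BBC

variable {n ℓ t : ℕ}

/-! ### Counting signers -/

lemma auxSigners_mono {A B : Finset (SignedAux n)} (h : A ⊆ B) (r : ℕ) (v : Bool) :
    auxSigners A r v ⊆ auxSigners B r v :=
  Finset.monotone_filter_right _ fun _ _ hi => h hi

lemma coinSigners_mono {A B : Finset (SignedCoin n)} (h : A ⊆ B) (r : ℕ) :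
    coinSigners A r ⊆ coinSigners B r :=
  Finset.monotone_filter_right _ fun _ _ hi => h hi

@[simp] lemma mem_auxSigners {A : Finset (SignedAux n)} {r : ℕ} {v : Bool} {i : Fin n} :
    i ∈ auxSigners A r v ↔ ⟨i, r, v⟩ ∈ A := by
  simp [auxSigners]

@[simp] lemma mem_roundSigners {A : Finset (SignedAux n)} {r : ℕ} {i : Fin n} :
    i ∈ roundSigners A r ↔ ∃ v : Bool, ⟨i, r, v⟩ ∈ A := by
  simp [roundSigners]

@[simp] lemma mem_coinSigners {A : Finset (SignedCoin n)} {r : ℕ} {i : Fin n} :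
    i ∈ coinSigners A r ↔ ⟨i, r⟩ ∈ A := by
  simp [coinSigners]

lemma card_roundSigners_le (A : Finset (SignedAux n)) (r : ℕ) (v : Bool) :
    (roundSigners A r).card ≤ (auxSigners A r v).card + (auxSigners A r (!v)).card := by
  refine le_trans (Finset.card_le_card ?_) (Finset.card_union_le _ _)
  intro i hi
  obtain ⟨w, hw⟩ := mem_roundSigners.1 hi
  rw [Finset.mem_union, mem_auxSigners, mem_auxSigners]
  cases v <;> cases w <;> simp [hw]

/-- Two sets of processes whose sizes add up to more than `n + t` have a common element outside
of any given set of at most `t` processes. -/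
lemma exists_common_of_card {S T F : Finset (Fin n)} (h : n + t < S.card + T.card)
    (hF : F.card ≤ t) : ∃ i, i ∈ S ∧ i ∈ T ∧ i ∉ F := by
  have h1 : (S ∪ T).card + (S ∩ T).card = S.card + T.card := Finset.card_union_add_card_inter S T
  have h2 : (S ∪ T).card ≤ n := by simpa using Finset.card_le_univ (S ∪ T)
  obtain ⟨i, hi, hiF⟩ := Finset.exists_mem_notMem_of_card_lt_card
    (show F.card < (S ∩ T).card by omega)
  exact ⟨i, (Finset.mem_inter.1 hi).1, (Finset.mem_inter.1 hi).2, hiF⟩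

/-! ### The predicate `is_valid` in terms of the true coins -/

/-- The largest round `s` with `1 ≤ s < r` whose coin is `¬ v`, or `0` if there is none. This is
`prevRound` evaluated with full knowledge of the coins `c`. -/
def lastOpposite (c : ℕ → Bool) (r : ℕ) (v : Bool) : ℕ :=
  Nat.findGreatest (fun s => s ≠ 0 ∧ c s = !v) (r - 1)

lemma lastOpposite_lt (c : ℕ → Bool) {r : ℕ} (hr : r ≠ 0) (v : Bool) :
    lastOpposite c r v < r := by
  have : lastOpposite c r v ≤ r - 1 := Nat.findGreatest_le _
  omega

lemma le_lastOpposite {c : ℕ → Bool} {s r : ℕ} {v : Bool} (hs : s ≠ 0) (hsr : s < r)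
    (h : c s = !v) : s ≤ lastOpposite c r v :=
  Nat.le_findGreatest (by omega) ⟨hs, h⟩

lemma lastOpposite_succ_of_eq {c : ℕ → Bool} {r : ℕ} {v : Bool} (hr : r ≠ 0) (h : c r = !v) :
    lastOpposite c (r + 1) v = r := by
  obtain ⟨s, rfl⟩ := Nat.exists_eq_succ_of_ne_zero hr
  simp only [lastOpposite, Nat.add_sub_cancel]
  rw [Nat.findGreatest_succ, if_pos ⟨hr, h⟩]

lemma lastOpposite_succ_of_ne {c : ℕ → Bool} {r : ℕ} {v : Bool} (hr : r ≠ 0) (h : c r = v) :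
    lastOpposite c (r + 1) v = lastOpposite c r v := by
  obtain ⟨s, rfl⟩ := Nat.exists_eq_succ_of_ne_zero hr
  simp only [lastOpposite, Nat.add_sub_cancel]
  rw [Nat.findGreatest_succ, if_neg (by simp [h])]
  rfl

/-- The number of messages `AUX(q, v)` by which `is_valid` lets round `q` support a later
round. -/
def quorum (n t q : ℕ) : ℕ := if q = 0 then t + 1 else n - t

lemma lt_quorum (ht : 3 * t < n) (q : ℕ) : t < quorum n t q := by
  unfold quorum; split_ifs <;> omega

/-- The predicate `is_valid(r, v, A)`, evaluated with full knowledge of the coins `c`. -/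
def Supported (t : ℕ) (c : ℕ → Bool) (r : ℕ) (v : Bool) (A : Finset (SignedAux n)) : Prop :=
  r ≠ 0 → quorum n t (lastOpposite c r v) ≤ (auxSigners A (lastOpposite c r v) v).card

lemma Supported.mono {c : ℕ → Bool} {r : ℕ} {v : Bool} {A B : Finset (SignedAux n)}
    (h : Supported t c r v A) (hAB : A ⊆ B) : Supported t c r v B := fun hr =>
  (h hr).trans (Finset.card_le_card (auxSigners_mono hAB _ _))

lemma supported_one {c : ℕ → Bool} {v : Bool} {A : Finset (SignedAux n)}
    (h : t + 1 ≤ (auxSigners A 0 v).card) : Supported t c 1 v A := fun _ => by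
  simpa [lastOpposite, quorum] using h

/-- An estimate supported in round `r` stays supported in round `r + 1` if the coin of round `r`
agrees with it, or if it has a quorum in round `r`. -/
lemma Supported.succ {c : ℕ → Bool} {r : ℕ} {v : Bool} {A : Finset (SignedAux n)} (hr : r ≠ 0)
    (h : Supported t c r v A) (h' : c r = v ∨ n - t ≤ (auxSigners A r v).card) :
    Supported t c (r + 1) v A := fun _ => by
  by_cases hc : c r = v
  · rw [lastOpposite_succ_of_ne hr hc]
    exact h hr
  · have hc' : c r = !v := by revert hc; cases c r <;> cases v <;> simp
    rw [lastOpposite_succ_of_eq hr hc', quorum, if_neg hr]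
    exact h'.resolve_left hc

/-- The coin map `cm` holds exactly the true coins of the rounds `1, …, m`. -/
def Knows (c : ℕ → Bool) (cm : CoinMap) (m : ℕ) : Prop :=
  ∀ q, cm.lookup q = if 1 ≤ q ∧ q ≤ m then some (c q) else none

lemma Knows.nil (c : ℕ → Bool) : Knows c [] 0 := fun q => by
  rw [if_neg (by omega)]; rfl

lemma Knows.cons {c : ℕ → Bool} {cm : CoinMap} {m : ℕ} (h : Knows c cm m) :
    Knows c ((m + 1, c (m + 1)) :: cm) (m + 1) := fun q => by
  rw [List.lookup_cons]
  by_cases hq : q = m + 1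
  · subst hq; simp
  · have : (q == m + 1) = false := by simpa using hq
    rw [this, h q]
    have : (1 ≤ q ∧ q ≤ m) ↔ (1 ≤ q ∧ q ≤ m + 1) := by omega
    simp only [this]

lemma findGreatest_congr {P Q : ℕ → Prop} [DecidablePred P] [DecidablePred Q] {m : ℕ}
    (h : ∀ s ≤ m, P s ↔ Q s) : Nat.findGreatest P m = Nat.findGreatest Q m := by
  induction m with
  | zero => simp
  | succ m ih =>
    simp only [Nat.findGreatest_succ, h (m + 1) le_rfl, ih fun s hs => h s (by omega)]

lemma Knows.prevRound_eq {c : ℕ → Bool} {cm : CoinMap} {m r : ℕ} (h : Knows c cm m)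
    (hr : r ≤ m + 1) (v : Bool) : prevRound cm r v = lastOpposite c r v := by
  refine findGreatest_congr fun s hs => ?_
  rw [h s]
  rcases Nat.eq_zero_or_pos s with rfl | h0
  · simp
  · rw [if_pos (by omega)]
    simp [h0.ne']

lemma Knows.isValid_iff {c : ℕ → Bool} {cm : CoinMap} {m r : ℕ} (h : Knows c cm m)
    (ht : 3 * t < n) (hr : r ≤ m + 1) (v : Bool) (P : Finset (SignedAux n)) :
    isValid n t cm r v P = true ↔ Supported t c r v P := by
  unfold isValid Supported
  rw [h.prevRound_eq hr]
  split_ifs with h0 h1 h2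
  · simp [h0]
  · subst h1
    simp [lastOpposite, quorum]
  · simp [h2.1, quorum, h2.2]
  · by_cases hq : lastOpposite c r v = 0
    · have h3 : ¬ t + 1 ≤ (auxSigners P 0 v).card := fun h3 => h2 ⟨hq, hq ▸ h3⟩
      simp only [hq, quorum, decide_eq_true_eq, if_pos]
      omega
    · simp [quorum, hq, h0]

/-- A trimmed set of proofs only holds messages of earlier rounds. -/
lemma Knows.round_lt_of_isTrimmed {c : ℕ → Bool} {cm : CoinMap} {m r : ℕ} (h : Knows c cm m)
    (ht : 3 * t < n) (hr : r ≤ m + 1) {v : Bool} {P Q : Finset (SignedAux n)}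
    (hQ : IsTrimmed n t cm r v P Q) {a : SignedAux n} (ha : a ∈ Q) : a.round < r := by
  obtain ⟨-, hv, hmin⟩ := hQ
  have hna : ¬ Supported t c r v (Q.erase a) := fun hs =>
    Bool.false_ne_true ((hmin a ha).symm.trans ((h.isValid_iff ht hr v _).2 hs))
  have hs : Supported t c r v Q := (h.isValid_iff ht hr v _).1 hv
  have hr0 : r ≠ 0 := fun h0 => hna fun h1 => absurd h0 h1
  have : a.round = lastOpposite c r v := by
    by_contra hne
    refine hna fun hr => (hs hr).trans (Finset.card_le_card fun i hi => ?_)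
    rw [mem_auxSigners] at hi ⊢
    refine Finset.mem_erase.2 ⟨?_, hi⟩
    rintro rfl
    exact hne rfl
  rw [this]
  exact lastOpposite_lt c hr0 v

/-! ### Invariants of a single process -/

/-- The number of steps that the main thread has made: two up to the first loop, and five for each
round. -/
def Local.steps (s : Local n) : ℕ :=
  match s.pc with
  | .start => 0
  | .waitProposals => 1
  | .roundStart => 5 * s.round + 2
  | .waitAux => 5 * s.round - 2
  | .sendCoin => 5 * s.round - 1
  | .waitCoin => 5 * s.round
  | .finish => 5 * s.round + 1

/-- The last round whose coin the process has computed. -/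
def Local.known (s : Local n) : ℕ :=
  match s.pc with
  | .roundStart => s.round
  | .finish => s.round
  | _ => s.round - 1

/-- The process has updated its estimate in the current round, but has not finished the round. -/
def Local.afterVote (s : Local n) : Prop := s.pc = .sendCoin ∨ s.pc = .waitCoin ∨ s.pc = .finish

/-- What holds of the local state of every process at all times, where `c` are the true coins. -/
structure LocalInv (t : ℕ) (c : ℕ → Bool) (s : Local n) : Prop where
  fresh : s.pc = .start → s.auxValues = ∅
  round_zero : s.pc = .start ∨ s.pc = .waitProposals → s.round = 0
  round_pos : s.pc = .waitAux ∨ s.afterVote → 1 ≤ s.round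
  knows : Knows c s.coinMap s.known
  /-- Messages of rounds whose coin is not yet known have been accepted by the handler
  themselves, not merely as proofs of other messages. -/
  supported : ∀ a ∈ s.auxValues, s.known < a.round → Supported t c a.round a.value s.auxValues
  est_roundStart : s.pc = .roundStart →
    ∃ e, s.est = some e ∧ Supported t c (s.round + 1) e s.auxValues
  est_supported : s.afterVote → ∀ e, s.est ≠ some (!e) → Supported t c s.round e s.auxValues
  est_quorum : s.afterVote → ∀ e, s.est = some e → n - t ≤ (auxSigners s.auxValues s.round e).card
  decision : ∀ b, s.decision = some b →
    ∃ r, 1 ≤ r ∧ c r = b ∧ n - t ≤ (auxSigners s.auxValues r b).card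
  coins : ∀ q, 1 ≤ q → q ≤ s.known → n - t ≤ (coinSigners s.coins q).card

lemma LocalInv.initial (c : ℕ → Bool) : LocalInv t c (Local.initial n) where
  fresh _ := rfl
  round_zero _ := rfl
  round_pos h := by simp [Local.initial, Local.afterVote] at h
  knows := Knows.nil c
  supported := by simp [Local.initial]
  est_roundStart h := by simp [Local.initial] at h
  est_supported h := by simp [Local.initial, Local.afterVote] at h
  est_quorum h := by simp [Local.initial, Local.afterVote] at h
  decision := by simp [Local.initial]
  coins := by simp only [Local.initial, Local.known]; omega

/-- The possible steps of the main thread, one constructor for each control point: the state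
reached from `s` and the message that is broadcast. -/
inductive MainStep (t : ℕ) (c : ℕ → Bool) (i : Fin n) (v : Bool) (s : Local n) :
    Local n → Option (Msg n) → Prop
  | start (h : s.pc = .start) :
    MainStep t c i v s { s with pc := .waitProposals, round := 0, auxValues := ∅, coinMap := [] }
      (some (.auxProof ⟨i, 0, v⟩ ∅))
  | propose (h : s.pc = .waitProposals) (hq : n - t ≤ (roundSigners s.auxValues s.round).card) :
    MainStep t c i v s { s with
      pc := .roundStart
      est := some (if t + 1 ≤ (auxSigners s.auxValues s.round false).card
        then false else true) } none
  | roundStart (h : s.pc = .roundStart) (e : Bool) (he : s.est = some e)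
      (P : Finset (SignedAux n)) (hP : P ⊆ s.auxValues)
      (hv : isValid n t s.coinMap (s.round + 1) e P = true) :
    MainStep t c i v s { s with pc := .waitAux, round := s.round + 1 }
      (some (.auxProof ⟨i, s.round + 1, e⟩ P))
  | vote (h : s.pc = .waitAux) (hq : n - t ≤ (roundSigners s.auxValues s.round).card) :
    MainStep t c i v s { s with
      pc := .sendCoin
      est := if n - t ≤ (auxSigners s.auxValues s.round false).card then some false
        else if n - t ≤ (auxSigners s.auxValues s.round true).card then some true
        else none } none
  | sendCoin (h : s.pc = .sendCoin) :
    MainStep t c i v s { s with pc := .waitCoin } (some (.coin ⟨i, s.round⟩))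
  | toss (h : s.pc = .waitCoin) (hq : n - t ≤ (coinSigners s.coins s.round).card) :
    MainStep t c i v s { s with
      pc := .finish
      coinMap := (s.round, c s.round) :: s.coinMap } none
  | finish (h : s.pc = .finish) (b : Bool) (hb : s.coinMap.lookup s.round = some b) :
    MainStep t c i v s { s with
      pc := .roundStart
      decision :=
        if s.decision = none ∧ n - t ≤ (auxSigners s.auxValues s.round b).card
        then some b else s.decision
      est := some (s.est.getD b) } none

lemma mainStep_spec {H : Oracle ℓ} {i : Fin n} {v : Bool} {P : Finset (SignedAux n)}
    {s s' : Local n} {m : Option (Msg n)} (h : mainStep t H i v P s = some (s', m)) :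
    MainStep t (coinOf H) i v s s' m := by
  unfold mainStep at h
  split at h <;> rename_i hpc
  · cases h; exact .start hpc
  · by_cases hq : n - t ≤ (roundSigners s.auxValues s.round).card
    · rw [if_pos hq] at h
      cases h; exact .propose hpc hq
    · rw [if_neg hq] at h; cases h
  · split at h
    · cases h
    · rename_i e he
      split_ifs at h with hP
      cases h; exact .roundStart hpc e he P hP.1 hP.2
  · by_cases hq : n - t ≤ (roundSigners s.auxValues s.round).card
    · rw [if_pos hq] at h
      cases h; exact .vote hpc hq
    · rw [if_neg hq] at h; cases h
  · cases h; exact .sendCoin hpc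
  · split_ifs at h with hq
    cases h; exact .toss hpc hq
  · split at h
    · cases h
    · rename_i b hb
      cases h; exact .finish hpc b hb

lemma MainStep.steps_eq {c : ℕ → Bool} {i : Fin n} {v : Bool} {s s' : Local n}
    {m : Option (Msg n)} (h : MainStep t c i v s s' m) (hs : LocalInv t c s) :
    s'.steps = s.steps + 1 := by
  have h0 := hs.round_zero
  have h1 := hs.round_pos
  cases h <;> rename_i h <;> simp_all [Local.steps, Local.afterVote] <;> omega

/-- A quorum of messages of one round without a quorum for either value has both values, hence
supports both. -/
lemma LocalInv.supported_vote {c : ℕ → Bool} {s : Local n} (hs : LocalInv t c s)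
    (hpc : s.pc = .waitAux) (hq : n - t ≤ (roundSigners s.auxValues s.round).card) (e : Bool)
    (he : ¬ n - t ≤ (auxSigners s.auxValues s.round (!e)).card) :
    Supported t c s.round e s.auxValues := by
  have h1 := card_roundSigners_le s.auxValues s.round e
  obtain ⟨i, hi⟩ := Finset.card_pos.1
    (show 0 < (auxSigners s.auxValues s.round e).card by omega)
  have hr := hs.round_pos (Or.inl hpc)
  refine hs.supported _ (mem_auxSigners.1 hi) ?_
  simp only [Local.known, hpc]
  omega

lemma MainStep.localInv {c : ℕ → Bool} {i : Fin n} {v : Bool} {s s' : Local n}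
    {m : Option (Msg n)} (h : MainStep t c i v s s' m) (hs : LocalInv t c s) (ht : 3 * t < n) :
    LocalInv t c s' := by
  have h0 := hs.round_zero
  have h1 := hs.round_pos
  have hk := hs.knows
  have hsu := hs.supported
  have hd := hs.decision
  have hc := hs.coins
  cases h with
  | start h =>
    have hA := hs.fresh h
    refine ⟨?_, ?_, ?_, Knows.nil c, ?_, ?_, ?_, ?_, ?_, ?_⟩ <;>
      simp only [Local.known, Local.afterVote]
    any_goals simp [-tsub_le_iff_right, -Nat.sub_le_iff_le_add, -Bool.forall_bool]
    · rwa [hA] at hd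
    · omega
  | propose h hq =>
    have hr := h0 (Or.inr h)
    have hkn : s.known = 0 := by simp [Local.known, h, hr]
    refine ⟨?_, ?_, ?_, ?_, ?_, ?_, ?_, ?_, hd, ?_⟩ <;> simp only [Local.known, Local.afterVote]
    any_goals simp [-tsub_le_iff_right, -Nat.sub_le_iff_le_add, -Bool.forall_bool]
    · rw [hr, ← hkn]; exact hk
    · intro a ha har
      exact hsu a ha (by omega)
    · rw [hr] at hq ⊢
      have h2 := card_roundSigners_le s.auxValues 0 false
      rw [Bool.not_false] at h2
      by_cases h3 : t < (auxSigners s.auxValues 0 false).card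
      · exact Or.inl ⟨h3, supported_one h3⟩
      · exact Or.inr ⟨not_lt.1 h3, supported_one (by omega)⟩
    · omega
  | roundStart h e he P hP hv =>
    have hkn : s.known = s.round := by simp [Local.known, h]
    refine ⟨?_, ?_, ?_, ?_, ?_, ?_, ?_, ?_, hd, ?_⟩ <;> simp only [Local.known, Local.afterVote]
    any_goals simp [-tsub_le_iff_right, -Nat.sub_le_iff_le_add, -Bool.forall_bool]
    · rw [← hkn]; exact hk
    · intro a ha har
      exact hsu a ha (by omega)
    · intro q hq1 hq2
      exact hc q hq1 (by omega)
  | vote h hq =>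
    have hkn : s.known = s.round - 1 := by simp [Local.known, h]
    refine ⟨?_, ?_, ?_, ?_, ?_, ?_, ?_, ?_, hd, ?_⟩ <;> simp only [Local.known, Local.afterVote]
    any_goals simp [-tsub_le_iff_right, -Nat.sub_le_iff_le_add, -Bool.forall_bool]
    · exact h1 (Or.inl h)
    · rw [← hkn]; exact hk
    · intro a ha har
      exact hsu a ha (by omega)
    · have key := hs.supported_vote h hq
      have hlt : ∀ e, n - t ≤ (auxSigners s.auxValues s.round e).card →
          Supported t c s.round e s.auxValues := fun e he => by
        obtain ⟨i, hi⟩ := Finset.card_pos.1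
          (show 0 < (auxSigners s.auxValues s.round e).card by omega)
        have hr := hs.round_pos (Or.inl h)
        exact hs.supported _ (mem_auxSigners.1 hi) (by simp only; omega)
      intro e
      split_ifs with h2 h3
      · cases e <;> simp [hlt false h2]
      · cases e <;> simp [hlt true h3]
      · cases e <;> simp [key false h3, key true h2]
    · split_ifs with h2 h3 <;> simp_all
    · intro q hq1 hq2
      exact hc q hq1 (by omega)
  | sendCoin h =>
    have hav : s.afterVote := Or.inl h
    have hkn : s.known = s.round - 1 := by simp [Local.known, h]
    refine ⟨?_, ?_, ?_, ?_, ?_, ?_, fun _ => hs.est_supported hav, fun _ => hs.est_quorum hav,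
      hd, ?_⟩ <;> simp only [Local.known, Local.afterVote]
    any_goals simp [-tsub_le_iff_right, -Nat.sub_le_iff_le_add, -Bool.forall_bool]
    · exact h1 (Or.inr hav)
    · rw [← hkn]; exact hk
    · intro a ha har
      exact hsu a ha (by omega)
    · intro q hq1 hq2
      exact hc q hq1 (by omega)
  | toss h hq =>
    have hav : s.afterVote := Or.inr (Or.inl h)
    have hkn : s.known = s.round - 1 := by simp [Local.known, h]
    have hr := h1 (Or.inr hav)
    refine ⟨?_, ?_, ?_, ?_, ?_, ?_, fun _ => hs.est_supported hav, fun _ => hs.est_quorum hav,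
      hd, ?_⟩ <;> simp only [Local.known, Local.afterVote]
    any_goals simp [-tsub_le_iff_right, -Nat.sub_le_iff_le_add, -Bool.forall_bool]
    · exact hr
    · rw [hkn] at hk
      have := hk.cons
      rwa [show s.round - 1 + 1 = s.round by omega] at this
    · intro a ha har
      exact hsu a ha (by omega)
    · intro q hq1 hq2
      rcases hq2.lt_or_eq with h2 | rfl
      · exact hc q hq1 (by omega)
      · exact hq
  | finish h b hb =>
    have hav : s.afterVote := Or.inr (Or.inr h)
    have hkn : s.known = s.round := by simp [Local.known, h]
    have hr := h1 (Or.inr hav)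
    have hcb : c s.round = b := by
      rw [hk s.round, if_pos (by omega)] at hb
      exact Option.some.inj hb
    refine ⟨?_, ?_, ?_, ?_, ?_, ?_, ?_, ?_, ?_, ?_⟩ <;> simp only [Local.known, Local.afterVote]
    any_goals simp [-tsub_le_iff_right, -Nat.sub_le_iff_le_add, -Bool.forall_bool]
    · rw [← hkn]; exact hk
    · intro a ha har
      exact hsu a ha (by omega)
    · cases he : s.est with
      | none =>
        exact (hs.est_supported hav b (by simp [he])).succ (by omega) (Or.inl hcb)
      | some e =>
        exact (hs.est_supported hav e (by simp [he])).succ (by omega)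
          (Or.inr (hs.est_quorum hav e he))
    · intro b'
      split_ifs with h2
      · rintro ⟨rfl⟩
        exact ⟨s.round, hr, hcb, h2.2⟩
      · exact hd b'
    · intro q hq1 hq2
      exact hc q hq1 (by omega)

lemma LocalInv.receive {c : ℕ → Bool} {s : Local n} (hs : LocalInv t c s) (m : Msg n) :
    LocalInv t c (receive m s) := by
  cases m with
  | auxProof a P =>
    exact ⟨hs.fresh, hs.round_zero, hs.round_pos, hs.knows, hs.supported, hs.est_roundStart,
      hs.est_supported, hs.est_quorum, hs.decision, hs.coins⟩
  | coin a =>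
    exact ⟨hs.fresh, hs.round_zero, hs.round_pos, hs.knows, hs.supported, hs.est_roundStart,
      hs.est_supported, hs.est_quorum, hs.decision, fun q h1 h2 => (hs.coins q h1 h2).trans
        (Finset.card_le_card (coinSigners_mono (Finset.subset_insert _ _) q))⟩

lemma LocalInv.ready_iff {c : ℕ → Bool} {s : Local n} (hs : LocalInv t c s) (r : ℕ) :
    s.ready r ↔ s.pc ≠ .start ∧ r ≤ s.known + 1 := by
  unfold Local.ready
  refine and_congr_right fun _ => ⟨fun h => ?_, fun h q hq => ?_⟩
  · by_contra hlt
    have := h (s.known + 1) (Finset.mem_Ico.2 (by omega))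
    rw [hs.knows, if_neg (by omega)] at this
    simp at this
  · rw [Finset.mem_Ico] at hq
    rw [hs.knows, if_pos (by omega)]
    rfl

/-- The effects of the reception handler: nothing happens, an unsupported message is discarded,
or a supported message is accepted with a trimmed set of proofs. -/
lemma handleStep_cases {c : ℕ → Bool} {s : Local n} (hs : LocalInv t c s) (ht : 3 * t < n)
    (a : SignedAux n) (P Q : Finset (SignedAux n)) :
    handleStep t a P Q s = s ∨
    (¬ Supported t c a.round a.value P ∧
      handleStep t a P Q s = { s with inbox := s.inbox.erase (a, P) }) ∨
    ((a, P) ∈ s.inbox ∧ s.pc ≠ .start ∧ Q ⊆ P ∧ Supported t c a.round a.value Q ∧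
      (∀ b ∈ Q, b.round < a.round ∧ b.round ≤ s.known) ∧
      handleStep t a P Q s = { s with
        inbox := s.inbox.erase (a, P)
        auxValues := s.auxValues ∪ {a} ∪ Q }) := by
  unfold handleStep
  split_ifs with h1 h2 h3
  · obtain ⟨h4, h5⟩ := (hs.ready_iff _).1 h1.2
    refine Or.inr (Or.inr ⟨h1.1, h4, h3.1, (hs.knows.isValid_iff ht h5 _ _).1 h3.2.1,
      fun b hb => ?_, rfl⟩)
    have := hs.knows.round_lt_of_isTrimmed ht h5 h3 hb
    exact ⟨this, by omega⟩
  · exact Or.inl rfl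
  · obtain ⟨h4, h5⟩ := (hs.ready_iff _).1 h1.2
    exact Or.inr (Or.inl ⟨fun hS => h2 ((hs.knows.isValid_iff ht h5 _ _).2 hS), rfl⟩)
  · exact Or.inl rfl

lemma LocalInv.handleStep {c : ℕ → Bool} {s : Local n} (hs : LocalInv t c s) (ht : 3 * t < n)
    (a : SignedAux n) (P Q : Finset (SignedAux n)) : LocalInv t c (handleStep t a P Q s) := by
  rcases handleStep_cases hs ht a P Q with h | ⟨-, h⟩ | ⟨-, hpc, -, hQ, hlt, h⟩ <;> rw [h]
  · exact hs
  · exact ⟨hs.fresh, hs.round_zero, hs.round_pos, hs.knows, hs.supported, hs.est_roundStart,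
      hs.est_supported, hs.est_quorum, hs.decision, hs.coins⟩
  · have hsub : s.auxValues ⊆ s.auxValues ∪ {a} ∪ Q := by
      rw [Finset.union_assoc]; exact Finset.subset_union_left
    have hcard : ∀ r v, (auxSigners s.auxValues r v).card ≤
        (auxSigners (s.auxValues ∪ {a} ∪ Q) r v).card := fun r v =>
      Finset.card_le_card (auxSigners_mono hsub r v)
    refine ⟨fun h => absurd h hpc, hs.round_zero, hs.round_pos, hs.knows, fun b hb hkb => ?_,
      fun h => ?_, fun h e he => (hs.est_supported h e he).mono hsub,
      fun h e he => (hs.est_quorum h e he).trans (hcard _ _), fun b hb => ?_, hs.coins⟩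
    · replace hkb : s.known < b.round := hkb
      simp only [Finset.mem_union, Finset.mem_singleton] at hb
      rcases hb with (hb | rfl) | hb
      · exact (hs.supported b hb hkb).mono hsub
      · exact hQ.mono Finset.subset_union_right
      · have := (hlt b hb).2
        omega
    · obtain ⟨e, he, hS⟩ := hs.est_roundStart h
      exact ⟨e, he, hS.mono hsub⟩
    · obtain ⟨r, h1, h2, h3⟩ := hs.decision b hb
      exact ⟨r, h1, h2, h3.trans (hcard _ _)⟩

lemma LocalInv.auxValues_eq {c : ℕ → Bool} {i : Fin n} {v : Bool} {s s' : Local n}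
    {m : Option (Msg n)} (h : MainStep t c i v s s' m) (hs : LocalInv t c s) :
    s'.auxValues = s.auxValues := by
  cases h <;> try rfl
  rename_i h
  exact (hs.fresh h).symm

/-- The main thread can only be blocked while it waits for messages: at the top of the loop the
whole set `A` is a valid set of proofs. -/
lemma LocalInv.mainStep_isSome {H : Oracle ℓ} {s : Local n} (hs : LocalInv t (coinOf H) s)
    (ht : 3 * t < n) (i : Fin n) (v : Bool)
    (haux : s.pc = .waitProposals ∨ s.pc = .waitAux →
      n - t ≤ (roundSigners s.auxValues s.round).card)
    (hcoin : s.pc = .waitCoin → n - t ≤ (coinSigners s.coins s.round).card) :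
    ∃ P, (mainStep t H i v P s).isSome = true := by
  refine ⟨s.auxValues, ?_⟩
  unfold mainStep
  split <;> rename_i hpc
  · rfl
  · rw [if_pos (haux (Or.inl hpc))]; rfl
  · obtain ⟨e, he, hS⟩ := hs.est_roundStart hpc
    have hkn : s.known = s.round := by simp [Local.known, hpc]
    rw [he]
    simp only
    rw [if_pos ⟨subset_rfl, (hs.knows.isValid_iff ht (by omega) _ _).2 hS⟩]
    rfl
  · rw [if_pos (haux (Or.inr hpc))]; rfl
  · rfl
  · rw [if_pos (hcoin hpc)]; rfl
  · have hkn : s.known = s.round := by simp [Local.known, hpc]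
    have hr := hs.round_pos (Or.inr (Or.inr (Or.inr hpc)))
    rw [hs.knows, if_pos (by omega)]
    rfl

/-! ### Events -/

@[simp] lemma broadcast_loc (C : Config n ℓ) (m : Option (Msg n)) :
    (broadcast C m).loc = C.loc := by cases m <;> rfl

@[simp] lemma broadcast_faulty (C : Config n ℓ) (m : Option (Msg n)) :
    (broadcast C m).faulty = C.faulty := by cases m <;> rfl

lemma network_subset_broadcast (C : Config n ℓ) (m : Option (Msg n)) :
    C.network ⊆ (broadcast C m).network := by
  cases m
  · exact subset_rfl
  · exact Finset.subset_union_left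

lemma signed_subset_broadcast (C : Config n ℓ) (m : Option (Msg n)) :
    C.signed ⊆ (broadcast C m).signed := by
  rcases m with _ | _ | _
  · exact subset_rfl
  · exact Finset.subset_insert _ _
  · exact Finset.subset_insert _ _

/-- The possible effects of an event on the configuration `C`. -/
inductive Transition (t : ℕ) (prop : Fin n → Bool) (H : Oracle ℓ) (C : Config n ℓ) :
    Config n ℓ → Prop
  | idle : Transition t prop H C C
  | step (i : Fin n) (hi : i ∉ C.faulty) (s : Local n) (m : Option (Msg n))
    (h : MainStep t (coinOf H) i (prop i) (C.loc i) s m) :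
    Transition t prop H C (broadcast (updateLoc C i s) m)
  | deliver (i : Fin n) (m : Msg n) (h : (i, m) ∈ C.network) :
    Transition t prop H C
      { updateLoc C i (receive m (C.loc i)) with network := C.network.erase (i, m) }
  | handle (i : Fin n) (a : SignedAux n) (P Q : Finset (SignedAux n)) :
    Transition t prop H C (updateLoc C i (handleStep t a P Q (C.loc i)))
  | corrupt (i : Fin n) (h : C.faulty.card < t) :
    Transition t prop H C { C with faulty := insert i C.faulty }
  | send (j : Fin n) (m : Msg n) (h : ∀ x ∈ m.signatures, C.available x) :
    Transition t prop H C { C with network := insert (j, m) C.network }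
  | query (x : OracleInput) :
    Transition t prop H C { C with answers := (x, H x) :: C.answers }

lemma execute_transition (prop : Fin n → Bool) (H : Oracle ℓ) (C : Config n ℓ) (e : Action n) :
    Transition t prop H C (execute t prop H C e) := by
  cases e <;> simp only [execute]
  · split_ifs with hi
    · exact .idle
    · split
      · exact .idle
      · rename_i s m h
        exact .step _ hi s m (mainStep_spec h)
  · split_ifs with h
    · exact .deliver _ _ h
    · exact .idle
  · split_ifs with hi
    · exact .idle
    · exact .handle _ _ _ _
  · split_ifs with h
    · exact .corrupt _ h
    · exact .idle
  · split_ifs with h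
    · exact .send _ _ h.2
    · exact .idle
  · split_ifs with h
    · exact .query _
    · exact .idle
  · exact .idle

/-- What an event can do to the local state of process `j`. -/
lemma Transition.loc_cases {prop : Fin n → Bool} {H : Oracle ℓ} {C C' : Config n ℓ}
    (h : Transition t prop H C C') (j : Fin n) :
    C'.loc j = C.loc j ∨
    (∃ m, MainStep t (coinOf H) j (prop j) (C.loc j) (C'.loc j) m) ∨
    (∃ m, (j, m) ∈ C.network ∧ C'.loc j = receive m (C.loc j)) ∨
    (∃ a P Q, C'.loc j = handleStep t a P Q (C.loc j)) := by
  cases h with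
  | step i hi s m h =>
    by_cases hj : j = i
    · subst hj
      refine Or.inr (Or.inl ⟨m, ?_⟩)
      simpa [updateLoc] using h
    · simp [updateLoc, hj]
  | deliver i m h =>
    by_cases hj : j = i
    · subst hj
      refine Or.inr (Or.inr (Or.inl ⟨m, h, ?_⟩))
      simp [updateLoc]
    · simp [updateLoc, hj]
  | handle i a P Q =>
    by_cases hj : j = i
    · subst hj
      refine Or.inr (Or.inr (Or.inr ⟨a, P, Q, ?_⟩))
      simp [updateLoc]
    · simp [updateLoc, hj]
  | _ => exact Or.inl rfl

lemma Transition.faulty_subset {prop : Fin n → Bool} {H : Oracle ℓ} {C C' : Config n ℓ}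
    (h : Transition t prop H C C') : C.faulty ⊆ C'.faulty := by
  cases h with
  | corrupt i h => exact Finset.subset_insert _ _
  | step i hi s m h => simp [updateLoc]
  | _ => exact subset_rfl

lemma Transition.signed_subset {prop : Fin n → Bool} {H : Oracle ℓ} {C C' : Config n ℓ}
    (h : Transition t prop H C C') : C.signed ⊆ C'.signed := by
  cases h with
  | step i hi s m h => exact signed_subset_broadcast (updateLoc C i s) m
  | _ => exact subset_rfl

lemma Transition.available {prop : Fin n → Bool} {H : Oracle ℓ} {C C' : Config n ℓ}
    (h : Transition t prop H C C') {x : Signed n} (hx : C.available x) : C'.available x :=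
  hx.imp (fun hi => h.faulty_subset hi) fun hi => h.signed_subset hi

/-! ### The messages of the main thread -/

/-- The number of steps of the main thread up to the broadcast of its `AUX` message of
round `r`. -/
def auxStep (r : ℕ) : ℕ := if r = 0 then 1 else 5 * r - 2

lemma auxStep_zero : auxStep 0 = 1 := rfl

lemma auxStep_of_ne {r : ℕ} (hr : r ≠ 0) : auxStep r = 5 * r - 2 := if_neg hr

lemma MainStep.inbox_eq {c : ℕ → Bool} {i : Fin n} {v : Bool} {s s' : Local n}
    {m : Option (Msg n)} (h : MainStep t c i v s s' m) : s'.inbox = s.inbox := by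
  cases h <;> rfl

lemma MainStep.coins_eq {c : ℕ → Bool} {i : Fin n} {v : Bool} {s s' : Local n}
    {m : Option (Msg n)} (h : MainStep t c i v s s' m) : s'.coins = s.coins := by
  cases h <;> rfl

lemma MainStep.aux_message {c : ℕ → Bool} {i : Fin n} {v : Bool} {s s' : Local n}
    {a : SignedAux n} {P : Finset (SignedAux n)}
    (h : MainStep t c i v s s' (some (.auxProof a P))) (hs : LocalInv t c s) (ht : 3 * t < n) :
    a.signer = i ∧ s.steps + 1 = auxStep a.round ∧ (a.round = 0 → a.value = v) ∧
      (a.round ≠ 0 → s.est = some a.value) ∧ P ⊆ s.auxValues ∧ Supported t c a.round a.value P := by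
  cases h with
  | start h =>
    refine ⟨rfl, ?_, fun _ => rfl, fun h => absurd rfl h, Finset.empty_subset _,
      fun h => absurd rfl h⟩
    simp [Local.steps, h, auxStep]
  | roundStart h e he _ hP hv =>
    have hkn : s.known = s.round := by simp [Local.known, h]
    refine ⟨rfl, ?_, fun h => by simp at h, fun _ => he, hP,
      (hs.knows.isValid_iff ht (by simp [hkn]) _ _).1 hv⟩
    simp only [Local.steps, h, auxStep]
    rw [if_neg (by omega)]
    omega

lemma MainStep.coin_message {c : ℕ → Bool} {i : Fin n} {v : Bool} {s s' : Local n}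
    {a : SignedCoin n} (h : MainStep t c i v s s' (some (.coin a))) (hs : LocalInv t c s) :
    a.signer = i ∧ 1 ≤ a.round ∧ s.steps + 1 = 5 * a.round := by
  cases h with
  | sendCoin h =>
    have := hs.round_pos (Or.inr (Or.inl h))
    refine ⟨rfl, this, ?_⟩
    simp only [Local.steps, h]
    omega

lemma MainStep.exists_aux_message {c : ℕ → Bool} {i : Fin n} {v : Bool} {s s' : Local n}
    {m : Option (Msg n)} (h : MainStep t c i v s s' m) (hs : LocalInv t c s) {r : ℕ}
    (hr : s.steps + 1 = auxStep r) : ∃ w P, m = some (.auxProof ⟨i, r, w⟩ P) := by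
  have h1 := hs.round_pos
  rcases Nat.eq_zero_or_pos r with rfl | hr0
  · rw [auxStep_zero] at hr
    cases h <;> rename_i h <;> simp_all [Local.steps, Local.afterVote] <;> omega
  · rw [auxStep_of_ne hr0.ne'] at hr
    cases h with
    | roundStart h e he P hP hv =>
      simp only [Local.steps, h] at hr
      obtain rfl : r = s.round + 1 := by omega
      exact ⟨e, P, rfl⟩
    | _ h => simp_all [Local.steps, Local.afterVote]; try omega

lemma MainStep.exists_coin_message {c : ℕ → Bool} {i : Fin n} {v : Bool} {s s' : Local n}
    {m : Option (Msg n)} (h : MainStep t c i v s s' m) (hs : LocalInv t c s) {r : ℕ}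
    (h1r : 1 ≤ r) (hr : s.steps + 1 = 5 * r) : m = some (.coin ⟨i, r⟩) := by
  have h1 := hs.round_pos
  cases h with
  | sendCoin h =>
    have := hs.round_pos (Or.inr (Or.inl h))
    simp only [Local.steps, h] at hr
    obtain rfl : r = s.round := by omega
    rfl
  | _ h => simp_all [Local.steps, Local.afterVote]; try omega

/-! ### Invariants of the system -/

/-- The processes whose signature of `AUX(r, v)` is available to the faulty processes. -/
def Config.auxAvailable (C : Config n ℓ) (r : ℕ) (v : Bool) : Finset (Fin n) :=
  Finset.univ.filter fun i => C.available ⟨i, .aux r v⟩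

@[simp] lemma Config.mem_auxAvailable {C : Config n ℓ} {r : ℕ} {v : Bool} {i : Fin n} :
    i ∈ C.auxAvailable r v ↔ C.available ⟨i, .aux r v⟩ := by
  simp [auxAvailable]

/-- The message `AUX_PROOF(a, P)` waits for the reception handler of process `i`, or `a` has been
accepted. -/
def Config.AuxReceived (C : Config n ℓ) (i : Fin n) (a : SignedAux n)
    (P : Finset (SignedAux n)) : Prop :=
  (a, P) ∈ (C.loc i).inbox ∨ a ∈ (C.loc i).auxValues

/-- The message `AUX_PROOF(a, P)` is on its way to process `i`, or has been received by it. -/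
def Config.AuxSent (C : Config n ℓ) (i : Fin n) (a : SignedAux n) (P : Finset (SignedAux n)) :
    Prop :=
  (i, .auxProof a P) ∈ C.network ∨ C.AuxReceived i a P

/-- The message `a` is on its way to process `i`, or has been received by it. -/
def Config.CoinSent (C : Config n ℓ) (i : Fin n) (a : SignedCoin n) : Prop :=
  (i, .coin a) ∈ C.network ∨ a ∈ (C.loc i).coins

/-- What holds of the configuration at all times. -/
structure Inv (t : ℕ) (prop : Fin n → Bool) (c : ℕ → Bool) (C : Config n ℓ) : Prop where
  card_faulty : C.faulty.card ≤ t
  loc : ∀ i, LocalInv t c (C.loc i)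
  auxValues : ∀ i, ∀ a ∈ (C.loc i).auxValues, C.available a.toSigned
  coins : ∀ i, ∀ a ∈ (C.loc i).coins, C.available a.toSigned
  inbox : ∀ i, ∀ p ∈ (C.loc i).inbox, ∀ x ∈ (Msg.auxProof p.1 p.2).signatures, C.available x
  network : ∀ p ∈ C.network, ∀ x ∈ p.2.signatures, C.available x
  signed_aux : ∀ i r v, ⟨i, .aux r v⟩ ∈ C.signed →
    auxStep r ≤ (C.loc i).steps ∧ (r = 0 → v = prop i) ∧
      (r ≠ 0 → quorum n t (lastOpposite c r v) ≤ (C.auxAvailable (lastOpposite c r v) v).card)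
  signed_unique : ∀ i r v w, ⟨i, .aux r v⟩ ∈ C.signed → ⟨i, .aux r w⟩ ∈ C.signed → v = w
  signed_coin : ∀ i r, ⟨i, .coin r⟩ ∈ C.signed → 1 ≤ r ∧ 5 * r ≤ (C.loc i).steps
  sent_aux : ∀ j r, auxStep r ≤ (C.loc j).steps →
    ∃ v P, Supported t c r v P ∧ ∀ i, C.AuxSent i ⟨j, r, v⟩ P
  sent_coin : ∀ j r, 1 ≤ r → 5 * r ≤ (C.loc j).steps → ∀ i, C.CoinSent i ⟨j, r⟩

lemma Inv.initial (prop : Fin n → Bool) (c : ℕ → Bool) :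
    Inv t prop c (Config.initial n ℓ) where
  card_faulty := by simp [Config.initial]
  loc _ := LocalInv.initial c
  auxValues := by simp [Config.initial, Local.initial]
  coins := by simp [Config.initial, Local.initial]
  inbox := by simp [Config.initial, Local.initial]
  network := by simp [Config.initial]
  signed_aux := by simp [Config.initial]
  signed_unique := by simp [Config.initial]
  signed_coin := by simp [Config.initial]
  sent_aux j r h := by
    simp only [Config.initial, Local.initial, Local.steps, auxStep] at h
    split_ifs at h <;> omega
  sent_coin j r h1 h := by
    simp only [Config.initial, Local.initial, Local.steps] at h
    omega

lemma receive_steps (m : Msg n) (s : Local n) : (receive m s).steps = s.steps := by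
  cases m <;> rfl

lemma receive_auxValues (m : Msg n) (s : Local n) :
    (receive m s).auxValues = s.auxValues := by
  cases m <;> rfl

lemma coins_subset_receive (m : Msg n) (s : Local n) : s.coins ⊆ (receive m s).coins := by
  cases m
  · exact subset_rfl
  · exact Finset.subset_insert _ _

lemma inbox_subset_receive (m : Msg n) (s : Local n) : s.inbox ⊆ (receive m s).inbox := by
  cases m
  · exact Finset.subset_insert _ _
  · exact subset_rfl

lemma handleStep_steps (a : SignedAux n) (P Q : Finset (SignedAux n)) (s : Local n) :
    (handleStep t a P Q s).steps = s.steps := by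
  unfold handleStep; split_ifs <;> rfl

lemma handleStep_coins (a : SignedAux n) (P Q : Finset (SignedAux n)) (s : Local n) :
    (handleStep t a P Q s).coins = s.coins := by
  unfold handleStep; split_ifs <;> rfl

lemma handleStep_inbox_subset (a : SignedAux n) (P Q : Finset (SignedAux n)) (s : Local n) :
    (handleStep t a P Q s).inbox ⊆ s.inbox := by
  unfold handleStep
  split_ifs
  · exact Finset.erase_subset _ _
  · exact subset_rfl
  · exact Finset.erase_subset _ _
  · exact subset_rfl

lemma auxValues_subset_handleStep (a : SignedAux n) (P Q : Finset (SignedAux n)) (s : Local n) :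
    s.auxValues ⊆ (handleStep t a P Q s).auxValues := by
  unfold handleStep
  split_ifs
  · simp only [Finset.union_assoc]; exact Finset.subset_union_left
  all_goals exact subset_rfl

lemma mem_handleStep_auxValues {a b : SignedAux n} {P Q : Finset (SignedAux n)} {s : Local n}
    (h : b ∈ (handleStep t a P Q s).auxValues) :
    b ∈ s.auxValues ∨ ((a, P) ∈ s.inbox ∧ (b = a ∨ b ∈ P)) := by
  unfold handleStep at h
  split_ifs at h with h1 h2 h3
  · simp only [Finset.mem_union, Finset.mem_singleton] at h
    rcases h with (h | h) | h
    · exact Or.inl h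
    · exact Or.inr ⟨h1.1, Or.inl h⟩
    · exact Or.inr ⟨h1.1, Or.inr (h3.1 h)⟩
  all_goals exact Or.inl h

section Monotone

variable {prop : Fin n → Bool} {H : Oracle ℓ} {C C' : Config n ℓ}

lemma Transition.steps_le (h : Transition t prop H C C') (hC : Inv t prop (coinOf H) C)
    (j : Fin n) : (C.loc j).steps ≤ (C'.loc j).steps := by
  rcases h.loc_cases j with h | ⟨m, h⟩ | ⟨m, -, h⟩ | ⟨a, P, Q, h⟩
  · rw [h]
  · rw [h.steps_eq (hC.loc j)]; omega
  · rw [h, receive_steps]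
  · rw [h, handleStep_steps]

lemma Transition.auxValues_subset (h : Transition t prop H C C') (hC : Inv t prop (coinOf H) C)
    (j : Fin n) : (C.loc j).auxValues ⊆ (C'.loc j).auxValues := by
  rcases h.loc_cases j with h | ⟨m, h⟩ | ⟨m, -, h⟩ | ⟨a, P, Q, h⟩
  · rw [h]
  · rw [(hC.loc j).auxValues_eq h]
  · rw [h, receive_auxValues]
  · rw [h]; exact auxValues_subset_handleStep a P Q _

lemma Transition.coins_subset (h : Transition t prop H C C') (j : Fin n) :
    (C.loc j).coins ⊆ (C'.loc j).coins := by
  rcases h.loc_cases j with h | ⟨m, h⟩ | ⟨m, -, h⟩ | ⟨a, P, Q, h⟩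
  · rw [h]
  · rw [h.coins_eq]
  · rw [h]; exact coins_subset_receive m _
  · rw [h, handleStep_coins]

/-- The handler only removes a supported message by accepting it. -/
lemma Transition.auxReceived (h : Transition t prop H C C') (hC : Inv t prop (coinOf H) C)
    (ht : 3 * t < n) {i : Fin n} {a : SignedAux n} {P : Finset (SignedAux n)}
    (hP : Supported t (coinOf H) a.round a.value P) (ha : C.AuxReceived i a P) :
    C'.AuxReceived i a P := by
  rcases ha with ha | ha
  · unfold Config.AuxReceived
    rcases h.loc_cases i with h | ⟨m, h⟩ | ⟨m, -, h⟩ | ⟨b, R, Q, h⟩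
    · rw [h]; exact Or.inl ha
    · rw [h.inbox_eq]; exact Or.inl ha
    · rw [h]; exact Or.inl (inbox_subset_receive m _ ha)
    · rw [h]
      rcases handleStep_cases (hC.loc i) ht b R Q with h1 | ⟨h0, h1⟩ | ⟨-, -, -, -, -, h1⟩ <;>
        rw [h1]
      · exact Or.inl ha
      · refine Or.inl (Finset.mem_erase.2 ⟨?_, ha⟩)
        rintro h2
        obtain ⟨rfl, rfl⟩ := Prod.mk.inj h2
        exact h0 hP
      · by_cases heq : (a, P) = (b, R)
        · obtain ⟨rfl, rfl⟩ := Prod.mk.inj heq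
          exact Or.inr (by simp)
        · exact Or.inl (Finset.mem_erase.2 ⟨heq, ha⟩)
  · exact Or.inr (h.auxValues_subset hC i ha)

lemma Transition.auxSent (h : Transition t prop H C C') (hC : Inv t prop (coinOf H) C)
    (ht : 3 * t < n) {i : Fin n} {a : SignedAux n} {P : Finset (SignedAux n)}
    (hP : Supported t (coinOf H) a.round a.value P) (ha : C.AuxSent i a P) :
    C'.AuxSent i a P := by
  rcases ha with ha | ha
  · cases h with
    | step j hj s m h => exact Or.inl (network_subset_broadcast (updateLoc C j s) m ha)
    | deliver j m h =>
      by_cases heq : (i, Msg.auxProof a P) = (j, m)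
      · obtain ⟨rfl, rfl⟩ := Prod.mk.inj heq
        exact Or.inr (Or.inl (by simp [updateLoc, receive]))
      · exact Or.inl (Finset.mem_erase.2 ⟨heq, ha⟩)
    | send j m h => exact Or.inl (Finset.mem_insert_of_mem ha)
    | _ => exact Or.inl ha
  · exact Or.inr (h.auxReceived hC ht hP ha)

lemma Transition.coinSent (h : Transition t prop H C C') {i : Fin n} {a : SignedCoin n}
    (ha : C.CoinSent i a) : C'.CoinSent i a := by
  rcases ha with ha | ha
  · cases h with
    | step j hj s m h => exact Or.inl (network_subset_broadcast (updateLoc C j s) m ha)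
    | deliver j m h =>
      by_cases heq : (i, Msg.coin a) = (j, m)
      · obtain ⟨rfl, rfl⟩ := Prod.mk.inj heq
        exact Or.inr (by simp [updateLoc, receive])
      · exact Or.inl (Finset.mem_erase.2 ⟨heq, ha⟩)
    | send j m h => exact Or.inl (Finset.mem_insert_of_mem ha)
    | _ => exact Or.inl ha
  · exact Or.inr (h.coins_subset i ha)

lemma Transition.auxAvailable_subset (h : Transition t prop H C C') (r : ℕ) (v : Bool) :
    C.auxAvailable r v ⊆ C'.auxAvailable r v := fun _ hi =>
  Config.mem_auxAvailable.2 (h.available (Config.mem_auxAvailable.1 hi))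

/-- A new signature of an `AUX` message is made by a step of its owner that broadcasts the
message. -/
lemma Transition.signed_aux_cases (h : Transition t prop H C C') (hC : Inv t prop (coinOf H) C)
    (ht : 3 * t < n) {i : Fin n} {r : ℕ} {v : Bool} (hs : ⟨i, .aux r v⟩ ∈ C'.signed) :
    ⟨i, .aux r v⟩ ∈ C.signed ∨ ∃ P, MainStep t (coinOf H) i (prop i) (C.loc i) (C'.loc i)
      (some (.auxProof ⟨i, r, v⟩ P)) := by
  cases h with
  | step j hj s m h =>
    rcases m with _ | ⟨a, P⟩ | a
    · exact Or.inl hs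
    · rcases Finset.mem_insert.1 hs with heq | hs
      · obtain rfl := (h.aux_message (hC.loc j) ht).1
        obtain ⟨k, q, w⟩ := a
        simp only [SignedAux.toSigned, Signed.mk.injEq, Content.aux.injEq] at heq
        obtain ⟨rfl, rfl, rfl⟩ := heq
        refine Or.inr ⟨P, ?_⟩
        simpa [updateLoc] using h
      · exact Or.inl hs
    · rcases Finset.mem_insert.1 hs with hs | hs
      · simp [SignedCoin.toSigned] at hs
      · exact Or.inl hs
  | _ => exact Or.inl hs

lemma Transition.signed_coin_cases (h : Transition t prop H C C')
    (hC : Inv t prop (coinOf H) C) {i : Fin n} {r : ℕ} (hs : ⟨i, .coin r⟩ ∈ C'.signed) :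
    ⟨i, .coin r⟩ ∈ C.signed ∨ MainStep t (coinOf H) i (prop i) (C.loc i) (C'.loc i)
      (some (.coin ⟨i, r⟩)) := by
  cases h with
  | step j hj s m h =>
    rcases m with _ | ⟨a, P⟩ | a
    · exact Or.inl hs
    · rcases Finset.mem_insert.1 hs with hs | hs
      · simp [SignedAux.toSigned] at hs
      · exact Or.inl hs
    · rcases Finset.mem_insert.1 hs with heq | hs
      · obtain rfl := (h.coin_message (hC.loc j)).1
        obtain ⟨k, q⟩ := a
        simp only [SignedCoin.toSigned, Signed.mk.injEq, Content.coin.injEq] at heq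
        obtain ⟨rfl, rfl⟩ := heq
        refine Or.inr ?_
        simpa [updateLoc] using h
      · exact Or.inl hs
  | _ => exact Or.inl hs

/-- Either the main thread of `j` makes no step, or it makes one, which puts its message on the way
to every process. -/
lemma Transition.eq_or_step (h : Transition t prop H C C') (hC : Inv t prop (coinOf H) C)
    (j : Fin n) : (C'.loc j).steps = (C.loc j).steps ∨
      (C'.loc j).steps = (C.loc j).steps + 1 ∧
      ∃ m, MainStep t (coinOf H) j (prop j) (C.loc j) (C'.loc j) m ∧
        ∀ x ∈ m, ∀ i, (i, x) ∈ C'.network := by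
  cases h with
  | step i hi s m h =>
    by_cases hj : j = i
    · subst hj
      have h' : MainStep t (coinOf H) j (prop j) (C.loc j)
          ((broadcast (updateLoc C j s) m).loc j) m := by simpa [updateLoc] using h
      refine Or.inr ⟨h'.steps_eq (hC.loc j), m, h', ?_⟩
      rintro x hx k
      obtain rfl : m = some x := hx
      simp [broadcast]
    · simp [updateLoc, hj]
  | deliver i m h =>
    by_cases hj : j = i
    · subst hj; simp [updateLoc, receive_steps]
    · simp [updateLoc, hj]
  | handle i a P Q =>
    by_cases hj : j = i
    · subst hj; simp [updateLoc, handleStep_steps]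
    · simp [updateLoc, hj]
  | _ => exact Or.inl rfl

lemma Transition.inv (h : Transition t prop H C C') (hC : Inv t prop (coinOf H) C)
    (ht : 3 * t < n) : Inv t prop (coinOf H) C' where
  card_faulty := by
    have := hC.card_faulty
    cases h with
    | step i hi s m h => simpa [updateLoc] using this
    | corrupt _ h => exact (Finset.card_insert_le _ _).trans h
    | _ => exact this
  loc j := by
    rcases h.loc_cases j with h | ⟨m, h⟩ | ⟨m, -, h⟩ | ⟨a, P, Q, h⟩
    · rw [h]; exact hC.loc j
    · exact h.localInv (hC.loc j) ht
    · rw [h]; exact (hC.loc j).receive m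
    · rw [h]; exact (hC.loc j).handleStep ht a P Q
  auxValues j b hb := by
    refine h.available ?_
    rcases h.loc_cases j with h | ⟨m, h⟩ | ⟨m, -, h⟩ | ⟨a, P, Q, h⟩
    · rw [h] at hb; exact hC.auxValues j b hb
    · rw [(hC.loc j).auxValues_eq h] at hb; exact hC.auxValues j b hb
    · rw [h, receive_auxValues] at hb; exact hC.auxValues j b hb
    · rw [h] at hb
      rcases mem_handleStep_auxValues hb with hb | ⟨h1, rfl | hb⟩
      · exact hC.auxValues j b hb
      · exact hC.inbox j _ h1 _ (Finset.mem_insert_self _ _)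
      · exact hC.inbox j _ h1 _ (Finset.mem_insert_of_mem (Finset.mem_image_of_mem _ hb))
  coins j b hb := by
    refine h.available ?_
    rcases h.loc_cases j with h | ⟨m, h⟩ | ⟨m, hm, h⟩ | ⟨a, P, Q, h⟩
    · rw [h] at hb; exact hC.coins j b hb
    · rw [h.coins_eq] at hb; exact hC.coins j b hb
    · rw [h] at hb
      rcases m with ⟨a, P⟩ | a
      · exact hC.coins j b hb
      · rcases Finset.mem_insert.1 hb with rfl | hb
        · exact hC.network _ hm _ (Finset.mem_singleton_self _)
        · exact hC.coins j b hb
    · rw [h, handleStep_coins] at hb; exact hC.coins j b hb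
  inbox j p hp x hx := by
    refine h.available ?_
    rcases h.loc_cases j with h | ⟨m, h⟩ | ⟨m, hm, h⟩ | ⟨a, P, Q, h⟩
    · rw [h] at hp; exact hC.inbox j p hp x hx
    · rw [h.inbox_eq] at hp; exact hC.inbox j p hp x hx
    · rw [h] at hp
      rcases m with ⟨a, P⟩ | a
      · rcases Finset.mem_insert.1 hp with rfl | hp
        · exact hC.network _ hm x hx
        · exact hC.inbox j p hp x hx
      · exact hC.inbox j p hp x hx
    · rw [h] at hp; exact hC.inbox j p (handleStep_inbox_subset a P Q _ hp) x hx
  network p hp x hx := by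
    have h' := h
    cases h with
    | step i hi s m h =>
      rcases m with _ | m
      · exact h'.available (hC.network p hp x hx)
      · rcases Finset.mem_union.1 hp with hp | hp
        · exact h'.available (hC.network p hp x hx)
        · obtain ⟨k, -, rfl⟩ := Finset.mem_image.1 hp
          rcases m with ⟨a, P⟩ | a
          · rcases Finset.mem_insert.1 hx with rfl | hx
            · exact Or.inr (Finset.mem_insert_self _ _)
            · obtain ⟨b, hb, rfl⟩ := Finset.mem_image.1 hx
              exact h'.available
                (hC.auxValues i b ((h.aux_message (hC.loc i) ht).2.2.2.2.1 hb))
          · rw [Finset.mem_singleton.1 hx]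
            exact Or.inr (Finset.mem_insert_self _ _)
    | deliver i m h =>
      exact h'.available (hC.network p (Finset.mem_of_mem_erase hp) x hx)
    | send j m h =>
      rcases Finset.mem_insert.1 hp with rfl | hp
      · exact h'.available (h x hx)
      · exact h'.available (hC.network p hp x hx)
    | _ => exact h'.available (hC.network p hp x hx)
  signed_aux i r v hs := by
    rcases h.signed_aux_cases hC ht hs with hs | ⟨P, hm⟩
    · obtain ⟨h1, h2, h3⟩ := hC.signed_aux i r v hs
      exact ⟨h1.trans (h.steps_le hC i), h2, fun hr => (h3 hr).trans
        (Finset.card_le_card (h.auxAvailable_subset _ _))⟩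
    · obtain ⟨-, h1, h2, -, h3, h4⟩ := hm.aux_message (hC.loc i) ht
      refine ⟨by rw [hm.steps_eq (hC.loc i)]; exact h1.ge, h2, fun hr => (h4 hr).trans
        (Finset.card_le_card fun k hk => ?_)⟩
      rw [Config.mem_auxAvailable]
      exact h.available (hC.auxValues i _ (h3 (mem_auxSigners.1 hk)))
  signed_unique i r v w hv hw := by
    -- The owner makes its signature of round `r` at step `auxStep r`, so not twice.
    have key : ∀ v w, ⟨i, .aux r v⟩ ∈ C.signed → ∀ P, MainStep t (coinOf H) i (prop i) (C.loc i)
        (C'.loc i) (some (.auxProof ⟨i, r, w⟩ P)) → False := fun v w hv P hm => by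
      have h1 := (hC.signed_aux i r v hv).1
      have h2 := (hm.aux_message (hC.loc i) ht).2.1
      simp only at h2
      omega
    rcases h.signed_aux_cases hC ht hv with hv | ⟨P, hv⟩ <;>
      rcases h.signed_aux_cases hC ht hw with hw | ⟨R, hw⟩
    · exact hC.signed_unique i r v w hv hw
    · exact (key v w hv R hw).elim
    · exact (key w v hw P hv).elim
    · rcases Nat.eq_zero_or_pos r with rfl | hr
      · exact ((hv.aux_message (hC.loc i) ht).2.2.1 rfl).trans
          ((hw.aux_message (hC.loc i) ht).2.2.1 rfl).symm
      · have h1 := (hv.aux_message (hC.loc i) ht).2.2.2.1 hr.ne'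
        have h2 := (hw.aux_message (hC.loc i) ht).2.2.2.1 hr.ne'
        exact Option.some.inj (h1.symm.trans h2)
  signed_coin i r hs := by
    rcases h.signed_coin_cases hC hs with hs | hm
    · exact ⟨(hC.signed_coin i r hs).1, (hC.signed_coin i r hs).2.trans (h.steps_le hC i)⟩
    · obtain ⟨-, h1, h2⟩ := hm.coin_message (hC.loc i)
      exact ⟨h1, by rw [hm.steps_eq (hC.loc i)]; exact h2.ge⟩
  sent_aux j r hr := by
    have old : auxStep r ≤ (C.loc j).steps →
        ∃ v P, Supported t (coinOf H) r v P ∧ ∀ i, C'.AuxSent i ⟨j, r, v⟩ P := fun hr => by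
      obtain ⟨v, P, hP, hs⟩ := hC.sent_aux j r hr
      exact ⟨v, P, hP, fun i => h.auxSent hC ht hP (hs i)⟩
    rcases h.eq_or_step hC j with h1 | ⟨h1, m, hm, hn⟩
    · exact old (h1 ▸ hr)
    · by_cases hr' : auxStep r ≤ (C.loc j).steps
      · exact old hr'
      · obtain ⟨w, P, rfl⟩ := hm.exists_aux_message (hC.loc j) (r := r) (by omega)
        exact ⟨w, P, (hm.aux_message (hC.loc j) ht).2.2.2.2.2, fun i => Or.inl (hn _ rfl i)⟩
  sent_coin j r h1r hr i := by
    rcases h.eq_or_step hC j with h1 | ⟨h1, m, hm, hn⟩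
    · exact h.coinSent (hC.sent_coin j r h1r (h1 ▸ hr) i)
    · by_cases hr' : 5 * r ≤ (C.loc j).steps
      · exact h.coinSent (hC.sent_coin j r h1r hr' i)
      · obtain rfl := hm.exists_coin_message (hC.loc j) h1r (by omega)
        exact Or.inl (hn _ rfl i)

end Monotone

/-! ### Agreement and validity -/

section Config

variable {prop : Fin n → Bool} {c : ℕ → Bool} {C : Config n ℓ}

lemma Inv.auxSigners_subset (hC : Inv t prop c C) (i : Fin n) (r : ℕ) (v : Bool) :
    auxSigners (C.loc i).auxValues r v ⊆ C.auxAvailable r v := fun _ hj =>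
  Config.mem_auxAvailable.2 (hC.auxValues i _ (mem_auxSigners.1 hj))

lemma Inv.exists_signed (hC : Inv t prop c C) {r : ℕ} {v : Bool}
    (h : t < (C.auxAvailable r v).card) : ∃ i, i ∉ C.faulty ∧ ⟨i, .aux r v⟩ ∈ C.signed := by
  obtain ⟨i, hi, hiF⟩ := Finset.exists_mem_notMem_of_card_lt_card
    (hC.card_faulty.trans_lt h)
  exact ⟨i, hiF, (Config.mem_auxAvailable.1 hi).resolve_left hiF⟩

/-- Two values cannot both have a quorum in the same round. -/
lemma Inv.eq_of_quorum (hC : Inv t prop c C) (ht : 3 * t < n) {r : ℕ} {v w : Bool}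
    (hv : n - t ≤ (C.auxAvailable r v).card) (hw : n - t ≤ (C.auxAvailable r w).card) :
    v = w := by
  obtain ⟨i, hi, hi', hiF⟩ := exists_common_of_card (show n + t < (C.auxAvailable r v).card +
    (C.auxAvailable r w).card by omega)
    hC.card_faulty
  exact hC.signed_unique i r v w ((Config.mem_auxAvailable.1 hi).resolve_left hiF)
    ((Config.mem_auxAvailable.1 hi').resolve_left hiF)

/-- A quorum for the coin value of a round locks this value: in later rounds, non-faulty
processes do not sign the other one. -/
lemma Inv.locked (hC : Inv t prop c C) (ht : 3 * t < n) {r : ℕ} {b : Bool} (hr : 1 ≤ r)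
    (hb : c r = b) (hq : n - t ≤ (C.auxAvailable r b).card) (r' : ℕ) (hr' : r < r') (i : Fin n)
    (hi : i ∉ C.faulty) : ⟨i, .aux r' (!b)⟩ ∉ C.signed := by
  induction r' using Nat.strong_induction_on generalizing i with
  | _ r' ih =>
    intro hs
    have h1 := (hC.signed_aux i r' (!b) hs).2.2 (by omega)
    have hle : r ≤ lastOpposite c r' (!b) := le_lastOpposite (by omega) hr' (by simpa using hb)
    have hlt : lastOpposite c r' (!b) < r' := lastOpposite_lt c (by omega) _
    rcases hle.eq_or_lt with heq | hlt'
    · rw [← heq, quorum, if_neg (by omega)] at h1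
      simpa using hC.eq_of_quorum ht hq h1
    · obtain ⟨j, hj, hjs⟩ := hC.exists_signed ((lt_quorum ht _).trans_le h1)
      exact ih _ hlt hlt' j hj hjs

/-- If the non-faulty processes propose only `v`, they sign only `v`. -/
lemma Inv.not_signed_of_proposals (hC : Inv t prop c C) (ht : 3 * t < n) {v : Bool}
    (hv : ∀ i, i ∉ C.faulty → prop i = v) (r : ℕ) (i : Fin n) (hi : i ∉ C.faulty) :
    ⟨i, .aux r (!v)⟩ ∉ C.signed := by
  induction r using Nat.strong_induction_on generalizing i with
  | _ r ih =>
    intro hs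
    obtain ⟨-, h0, h1⟩ := hC.signed_aux i r (!v) hs
    rcases Nat.eq_zero_or_pos r with hr | hr
    · simpa [hv i hi] using h0 hr
    · obtain ⟨j, hj, hjs⟩ := hC.exists_signed ((lt_quorum ht _).trans_le (h1 hr.ne'))
      exact ih _ (lastOpposite_lt c hr.ne' _) j hj hjs

lemma Inv.decision (hC : Inv t prop c C) {i : Fin n} {b : Bool}
    (h : (C.loc i).decision = some b) :
    ∃ r, 1 ≤ r ∧ c r = b ∧ n - t ≤ (C.auxAvailable r b).card := by
  obtain ⟨r, h1, h2, h3⟩ := (hC.loc i).decision b h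
  exact ⟨r, h1, h2, h3.trans (Finset.card_le_card (hC.auxSigners_subset i r b))⟩

lemma Inv.eq_of_locked (hC : Inv t prop c C) (ht : 3 * t < n) {r q : ℕ} {b d : Bool}
    (hr : 1 ≤ r) (hrq : r ≤ q) (hb : c r = b) (hd : c q = d)
    (hrb : n - t ≤ (C.auxAvailable r b).card) (hqd : n - t ≤ (C.auxAvailable q d).card) :
    b = d := by
  rcases hrq.eq_or_lt with rfl | hlt
  · exact hb.symm.trans hd
  · by_contra hne
    obtain rfl : d = !b := by revert hne; cases b <;> cases d <;> simp
    obtain ⟨i, hi, his⟩ := hC.exists_signed (lt_of_lt_of_le (by omega) hqd)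
    exact hC.locked ht hr hb hrb q hlt i hi his

end Config

section Run

variable {prop : Fin n → Bool} {σ : Adversary n ℓ} {H : Oracle ℓ}

lemma run_transition (k : ℕ) :
    Transition t prop H (run t prop σ H k) (run t prop σ H (k + 1)) :=
  execute_transition prop H _ _

lemma run_inv (ht : 3 * t < n) (k : ℕ) : Inv t prop (coinOf H) (run t prop σ H k) := by
  induction k with
  | zero => exact Inv.initial prop _
  | succ k ih => exact (run_transition k).inv ih ht

lemma run_faulty_mono : Monotone fun k => (run t prop σ H k).faulty :=
  monotone_nat_of_le_succ fun k => (run_transition k).faulty_subset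

lemma run_auxAvailable_mono (r : ℕ) (v : Bool) :
    Monotone fun k => (run t prop σ H k).auxAvailable r v :=
  monotone_nat_of_le_succ fun k => (run_transition k).auxAvailable_subset r v

lemma run_steps_mono (ht : 3 * t < n) (i : Fin n) :
    Monotone fun k => ((run t prop σ H k).loc i).steps :=
  monotone_nat_of_le_succ fun k => (run_transition k).steps_le (run_inv ht k) i

lemma run_auxValues_mono (ht : 3 * t < n) (i : Fin n) :
    Monotone fun k => ((run t prop σ H k).loc i).auxValues :=
  monotone_nat_of_le_succ fun k => (run_transition k).auxValues_subset (run_inv ht k) i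

lemma run_coins_mono (i : Fin n) :
    Monotone fun k => ((run t prop σ H k).loc i).coins :=
  monotone_nat_of_le_succ fun k => (run_transition k).coins_subset i

lemma Decides.exists_quorum (ht : 3 * t < n) {i : Fin n} {b : Bool}
    (h : Decides (run t prop σ H) i b) : ∃ r k, 1 ≤ r ∧ coinOf H r = b ∧
      ∀ k' ≥ k, n - t ≤ ((run t prop σ H k').auxAvailable r b).card := by
  obtain ⟨k, hk⟩ := h
  obtain ⟨r, h1, h2, h3⟩ := (run_inv ht k).decision hk
  exact ⟨r, k, h1, h2, fun k' hk' =>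
    h3.trans (Finset.card_le_card (run_auxAvailable_mono r b hk'))⟩

theorem agreement_run (ht : 3 * t < n) : Agreement (run t prop σ H) := by
  intro i j b d _ _ hb hd
  obtain ⟨r, k, hr, hrb, hk⟩ := hb.exists_quorum ht
  obtain ⟨q, l, hq, hqd, hl⟩ := hd.exists_quorum ht
  have hC := run_inv (prop := prop) (σ := σ) (H := H) ht (max k l)
  have h1 := hk _ (le_max_left k l)
  have h2 := hl _ (le_max_right k l)
  rcases le_total r q with hrq | hrq
  · exact hC.eq_of_locked ht hr hrq hrb hqd h1 h2
  · exact (hC.eq_of_locked ht hq hrq hqd hrb h2 h1).symm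

/-- The set of faulty processes is eventually constant. -/
lemma exists_nonFaulty_iff (ρ : ℕ → Config n ℓ) (hρ : Monotone fun k => (ρ k).faulty) :
    ∃ K, ∀ k ≥ K, ∀ i, NonFaulty ρ i ↔ i ∉ (ρ k).faulty := by
  obtain ⟨K, hK⟩ := WellFoundedGT.monotone_chain_condition ⟨_, hρ⟩
  refine ⟨K, fun k hk i => ⟨fun h => h k, fun h l hl => h ?_⟩⟩
  have h1 : (ρ K).faulty = (ρ k).faulty := hK k hk
  have h2 : (ρ K).faulty = (ρ (max K l)).faulty := hK _ (le_max_left K l)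
  rw [← h1, h2]
  exact hρ (le_max_right K l) hl

theorem validity_run (ht : 3 * t < n) : Validity prop (run t prop σ H) := by
  intro v hv i b _ hb
  obtain ⟨r, k, -, -, hk⟩ := hb.exists_quorum ht
  obtain ⟨K, hK⟩ := exists_nonFaulty_iff (run t prop σ H) run_faulty_mono
  have hC := run_inv (prop := prop) (σ := σ) (H := H) ht (max k K)
  obtain ⟨j, hj, hjs⟩ := hC.exists_signed (v := b) (r := r)
    (lt_of_lt_of_le (by omega) (hk _ (le_max_left k K)))
  by_contra hne
  obtain rfl : b = !v := by revert hne; cases b <;> cases v <;> simp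
  exact hC.not_signed_of_proposals ht
    (fun l hl => hv l ((hK _ (le_max_right k K) l).2 hl)) r j hj hjs

end Run

/-! ### Progress through the rounds -/

/-- The number of steps determines the control point and the round. -/
lemma LocalInv.pc_round_eq {c : ℕ → Bool} {s s' : Local n} (hs : LocalInv t c s)
    (hs' : LocalInv t c s') (h : s.steps = s'.steps) : s.pc = s'.pc ∧ s.round = s'.round := by
  have h1 := hs.round_zero
  have h2 := hs.round_pos
  have h1' := hs'.round_zero
  have h2' := hs'.round_pos
  clear hs hs'
  simp only [Local.steps, Local.afterVote] at *
  generalize s.pc = p at *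
  generalize s'.pc = p' at *
  cases p <;> cases p' <;>
    simp only [reduceCtorEq, or_false, or_self, or_true, false_imp_iff,
      forall_const, true_and, false_and] at * <;> omega

section Run

variable {prop : Fin n → Bool} {σ : Adversary n ℓ} {H : Oracle ℓ}

lemma card_of_forall_nonFaulty (ht : 3 * t < n) {S : Finset (Fin n)}
    (hS : ∀ j, NonFaulty (run t prop σ H) j → j ∈ S) : n - t ≤ S.card := by
  obtain ⟨K, hK⟩ := exists_nonFaulty_iff (run t prop σ H) run_faulty_mono
  have h1 : (run t prop σ H K).faultyᶜ ⊆ S := fun j hj =>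
    hS j ((hK K le_rfl j).2 (Finset.mem_compl.1 hj))
  have h2 := Finset.card_le_card h1
  have h3 := (run_inv (prop := prop) (σ := σ) (H := H) ht K).card_faulty
  rw [Finset.card_compl, Fintype.card_fin] at h2
  omega

lemma run_auxReceived (ht : 3 * t < n) {i : Fin n} {a : SignedAux n} {P : Finset (SignedAux n)}
    (hP : Supported t (coinOf H) a.round a.value P) {k : ℕ}
    (h : (run t prop σ H k).AuxReceived i a P) {l : ℕ} (hl : k ≤ l) :
    (run t prop σ H l).AuxReceived i a P := by
  induction l, hl using Nat.le_induction with
  | base => exact h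
  | succ l _ ih => exact (run_transition l).auxReceived (run_inv ht l) ht hP ih

lemma run_auxSent (ht : 3 * t < n) {i : Fin n} {a : SignedAux n} {P : Finset (SignedAux n)}
    (hP : Supported t (coinOf H) a.round a.value P) {k : ℕ}
    (h : (run t prop σ H k).AuxSent i a P) {l : ℕ} (hl : k ≤ l) :
    (run t prop σ H l).AuxSent i a P := by
  induction l, hl using Nat.le_induction with
  | base => exact h
  | succ l _ ih => exact (run_transition l).auxSent (run_inv ht l) ht hP ih

lemma run_coinSent {i : Fin n} {a : SignedCoin n} {k : ℕ}
    (h : (run t prop σ H k).CoinSent i a) {l : ℕ} (hl : k ≤ l) :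
    (run t prop σ H l).CoinSent i a := by
  induction l, hl using Nat.le_induction with
  | base => exact h
  | succ l _ ih => exact (run_transition l).coinSent ih

lemma eventually_mem_auxValues (ht : 3 * t < n) (hF : FiniteDelays t prop H (run t prop σ H))
    {i : Fin n} (hi : NonFaulty (run t prop σ H) i) {a : SignedAux n} {P : Finset (SignedAux n)}
    (hP : Supported t (coinOf H) a.round a.value P) {k : ℕ}
    (h : (run t prop σ H k).AuxSent i a P)
    (hready : ∀ l ≥ k, ((run t prop σ H l).loc i).ready a.round) :
    ∀ᶠ l in Filter.atTop, a ∈ ((run t prop σ H l).loc i).auxValues := by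
  obtain ⟨l, hl, hal⟩ : ∃ l ≥ k, (run t prop σ H l).AuxReceived i a P := by
    rcases h with h | h
    · obtain ⟨l, hl, hnl⟩ := hF.delivery i hi k _ h
      exact ⟨l, hl, (run_auxSent ht hP (Or.inl h) hl).resolve_left hnl⟩
    · exact ⟨k, le_rfl, h⟩
  obtain ⟨m, hm⟩ : ∃ m, a ∈ ((run t prop σ H m).loc i).auxValues := by
    rcases id hal with h | h
    · obtain ⟨m, hlm, hm⟩ := hF.handling i hi l _ _ h (hready l hl)
      exact ⟨m, (run_auxReceived ht hP hal hlm).resolve_left hm⟩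
    · exact ⟨l, h⟩
  exact Filter.eventually_atTop.2 ⟨m, fun q hq => run_auxValues_mono ht i hq hm⟩

lemma eventually_mem_coins (hF : FiniteDelays t prop H (run t prop σ H))
    {i : Fin n} (hi : NonFaulty (run t prop σ H) i) {a : SignedCoin n} {k : ℕ}
    (h : (run t prop σ H k).CoinSent i a) :
    ∀ᶠ l in Filter.atTop, a ∈ ((run t prop σ H l).loc i).coins := by
  obtain ⟨m, hm⟩ : ∃ m, a ∈ ((run t prop σ H m).loc i).coins := by
    rcases h with h | h
    · obtain ⟨l, hl, hnl⟩ := hF.delivery i hi k _ h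
      exact ⟨l, (run_coinSent (Or.inl h) hl).resolve_left hnl⟩
    · exact ⟨k, h⟩
  exact Filter.eventually_atTop.2 ⟨m, fun q hq => run_coins_mono i hq hm⟩

/-- With finite delays no non-faulty process is blocked forever. -/
theorem exists_le_steps (ht : 3 * t < n) (hF : FiniteDelays t prop H (run t prop σ H)) (m : ℕ)
    (i : Fin n) (hi : NonFaulty (run t prop σ H) i) :
    ∃ k, m ≤ ((run t prop σ H k).loc i).steps := by
  induction m generalizing i with
  | zero => exact ⟨0, Nat.zero_le _⟩
  | succ m ih =>
    by_contra! hlt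
    obtain ⟨k, hk⟩ := ih i hi
    have hinv := fun l => (run_inv (prop := prop) (σ := σ) (H := H) ht l).loc i
    have hsteps : ∀ l ≥ k, ((run t prop σ H l).loc i).steps = m := fun l hl =>
      le_antisymm (Nat.le_of_lt_succ (hlt l)) (hk.trans (run_steps_mono ht i hl))
    -- The process stays at one control point of one round from time `k` on.
    have hpc : ∀ l ≥ k, ((run t prop σ H l).loc i).pc = ((run t prop σ H k).loc i).pc ∧
        ((run t prop σ H l).loc i).round = ((run t prop σ H k).loc i).round := fun l hl =>
      (hinv l).pc_round_eq (hinv k) ((hsteps l hl).trans (hsteps k le_rfl).symm)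
    set r := ((run t prop σ H k).loc i).round with hr
    have haux : ((run t prop σ H k).loc i).pc = .waitProposals ∨
        ((run t prop σ H k).loc i).pc = .waitAux →
        ∀ᶠ l in Filter.atTop,
          n - t ≤ (roundSigners ((run t prop σ H l).loc i).auxValues r).card := by
      intro hp
      have hm : auxStep r = m ∧ ((run t prop σ H k).loc i).pc ≠ .start ∧
          r ≤ ((run t prop σ H k).loc i).known + 1 := by
        rw [← hsteps k le_rfl]
        have h0 := (hinv k).round_zero
        have h1 := (hinv k).round_pos
        rcases hp with hp | hp
        · have : r = 0 := h0 (Or.inr hp)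
          simp [Local.steps, hp, this, auxStep]
        · have : 1 ≤ r := h1 (Or.inl hp)
          simp only [Local.steps, Local.known, hp]
          rw [auxStep_of_ne (by omega), ← hr]
          exact ⟨rfl, by simp, by omega⟩
      have key : ∀ j, NonFaulty (run t prop σ H) j → ∀ᶠ l in Filter.atTop,
          j ∈ roundSigners ((run t prop σ H l).loc i).auxValues r := fun j hj => by
        obtain ⟨l, hl⟩ := ih j hj
        rw [← hm.1] at hl
        obtain ⟨v, P, hP, hs⟩ := (run_inv (prop := prop) (σ := σ) (H := H) ht l).sent_aux j r hl
        refine (eventually_mem_auxValues ht hF hi (a := ⟨j, r, v⟩) hP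
          (run_auxSent ht (a := ⟨j, r, v⟩) hP (hs i) (le_max_left l k)) fun q hq => ?_).mono
          fun q hq => mem_roundSigners.2 ⟨v, hq⟩
        have hkq := hpc q ((le_max_right l k).trans hq)
        refine ((hinv q).ready_iff r).2 ⟨by rw [hkq.1]; exact hm.2.1, ?_⟩
        have h2 := hm.2.2
        simp only [Local.known] at h2 ⊢
        rw [hkq.1, hkq.2]
        exact h2
      have key' := Filter.eventually_all.2 fun j => Filter.eventually_imp_distrib_left.2 (key j)
      exact key'.mono fun l hl => card_of_forall_nonFaulty ht hl
    have hcoin : ((run t prop σ H k).loc i).pc = .waitCoin →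
        ∀ᶠ l in Filter.atTop, n - t ≤ (coinSigners ((run t prop σ H l).loc i).coins r).card := by
      intro hp
      have hr1 : 1 ≤ r := (hinv k).round_pos (Or.inr (Or.inr (Or.inl hp)))
      have hm : 5 * r = m := by
        rw [← hsteps k le_rfl]
        simp [Local.steps, hp, hr]
      have key : ∀ j, NonFaulty (run t prop σ H) j → ∀ᶠ l in Filter.atTop,
          j ∈ coinSigners ((run t prop σ H l).loc i).coins r := fun j hj => by
        obtain ⟨l, hl⟩ := ih j hj
        rw [← hm] at hl
        exact (eventually_mem_coins hF hi
          ((run_inv (prop := prop) (σ := σ) (H := H) ht l).sent_coin j r hr1 hl i)).mono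
          fun q hq => mem_coinSigners.2 hq
      have key' := Filter.eventually_all.2 fun j => Filter.eventually_imp_distrib_left.2 (key j)
      exact key'.mono fun l hl => card_of_forall_nonFaulty ht hl
    obtain ⟨l, ⟨hl1, hl2⟩, hkl⟩ := (((Filter.eventually_imp_distrib_left.2 haux).and
      (Filter.eventually_imp_distrib_left.2 hcoin)).and (Filter.eventually_ge_atTop k)).exists
    obtain ⟨hpcl, hrl⟩ := hpc l hkl
    have hsome := (hinv l).mainStep_isSome ht i (prop i)
      (by rw [hpcl, hrl]; exact hl1) (by rw [hpcl, hrl]; exact hl2)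
    obtain ⟨q, hq, hne⟩ := hF.progress i hi l hsome
    exact hne ((hpc q (hkl.trans hq)).1.trans hpcl.symm)

end Run

/-! ### When a coin is revealed -/

/-- The coin of round `r` can be computed by the faulty processes. -/
abbrev Config.coinRevealed (t : ℕ) (C : Config n ℓ) (r : ℕ) : Prop :=
  C.computable t (.thresholdSig (.coin r))

lemma Inv.coinRevealed_of_coins {prop : Fin n → Bool} {c : ℕ → Bool} {C : Config n ℓ}
    (hC : Inv t prop c C) {i : Fin n} {r : ℕ} (h : n - t ≤ (coinSigners (C.loc i).coins r).card) :
    C.coinRevealed t r := by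
  refine le_trans h (Finset.card_le_card fun j hj => ?_)
  simpa [SignedCoin.toSigned] using hC.coins i _ (mem_coinSigners.1 hj)

lemma Inv.coinRevealed_of_lt_steps {prop : Fin n → Bool} {c : ℕ → Bool} {C : Config n ℓ}
    (hC : Inv t prop c C) {i : Fin n} {r : ℕ} (hr : 1 ≤ r) (h : 5 * r < (C.loc i).steps) :
    C.coinRevealed t r := by
  refine hC.coinRevealed_of_coins ((hC.loc i).coins r hr ?_)
  have h0 := (hC.loc i).round_zero
  rcases hpc : (C.loc i).pc <;> simp only [Local.steps, Local.known, hpc] at h ⊢ <;> omega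

/-- Coins are revealed in the order of the rounds. -/
lemma Inv.coinRevealed_of_le {prop : Fin n → Bool} {c : ℕ → Bool} {C : Config n ℓ}
    (hC : Inv t prop c C) (ht : 3 * t < n) {r s : ℕ} (hr : 1 ≤ r) (hrs : r ≤ s)
    (h : C.coinRevealed t s) : C.coinRevealed t r := by
  rcases hrs.eq_or_lt with rfl | hlt
  · exact h
  · have h' : n - t ≤ (Finset.univ.filter fun i : Fin n => C.available ⟨i, .coin s⟩).card := h
    obtain ⟨i, hi, hiF⟩ := Finset.exists_mem_notMem_of_card_lt_card
      (hC.card_faulty.trans_lt (lt_of_lt_of_le (by omega) h'))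
    have hs := (hC.signed_coin i s ((Finset.mem_filter.1 hi).2.resolve_left hiF)).2
    exact hC.coinRevealed_of_lt_steps hr (lt_of_lt_of_le (by omega) hs)

lemma mainStep_congr {H H' : Oracle ℓ} {i : Fin n} {v : Bool} {P : Finset (SignedAux n)}
    {s : Local n} (h : n - t ≤ (coinSigners s.coins s.round).card →
      coinOf H s.round = coinOf H' s.round) :
    mainStep t H i v P s = mainStep t H' i v P s := by
  unfold mainStep
  split <;> try rfl
  split_ifs with hq
  · rw [h hq]
  · rfl

/-- As long as the coin of round `r` is not revealed, an event does not depend on the coins of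
rounds from `r` on. -/
lemma Inv.execute_congr {prop : Fin n → Bool} {c : ℕ → Bool} {C : Config n ℓ}
    (hC : Inv t prop c C) (ht : 3 * t < n) {H H' : Oracle ℓ} {r : ℕ} (hr : 1 ≤ r)
    (hH : ∀ x, (∀ s ≥ r, x ≠ .thresholdSig (.coin s)) → H x = H' x) (h : ¬ C.coinRevealed t r)
    (e : Action n) : execute t prop H C e = execute t prop H' C e := by
  have hlt : ∀ s, C.coinRevealed t s → s < r := fun s hs => by
    by_contra hsr
    exact h (hC.coinRevealed_of_le ht hr (by omega) hs)
  cases e with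
  | step i P =>
    simp only [execute]
    rw [mainStep_congr (H' := H')]
    intro hq
    have := hlt _ (hC.coinRevealed_of_coins hq)
    simp only [coinOf]
    rw [hH _ fun s hs => by simp; omega]
  | query x =>
    simp only [execute]
    split_ifs with hx
    · rw [hH x fun s hs hxs => ?_]
      rw [hxs] at hx
      have := hlt s hx
      omega
    · rfl
  | _ => rfl

section Run

variable {prop : Fin n → Bool} {σ : Adversary n ℓ} {H H' : Oracle ℓ}

lemma trace_congr (ht : 3 * t < n) {r : ℕ} (hr : 1 ≤ r)
    (hH : ∀ x, (∀ s ≥ r, x ≠ .thresholdSig (.coin s)) → H x = H' x) {k : ℕ}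
    (hk : ∀ j < k, ¬ (run t prop σ H j).coinRevealed t r) :
    trace t prop σ H k = trace t prop σ H' k := by
  induction k with
  | zero => rfl
  | succ k ih =>
    have h1 := (run_inv (prop := prop) (σ := σ) (H := H) ht k).execute_congr ht hr hH
      (hk k (Nat.lt_succ_self k))
    have h2 := ih fun j hj => hk j (hj.trans (Nat.lt_succ_self k))
    simp only [trace]
    rw [← h2]
    exact Prod.ext (h1 _) rfl

/-- Some process has the estimate `1` when it waits for the coin of round `r`, at a time when
this coin has never been revealed before. This determines the value on which the coin should fall
for the round to be useful. -/
def Favored (t : ℕ) (prop : Fin n → Bool) (σ : Adversary n ℓ) (r : ℕ) (H : Oracle ℓ) : Prop :=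
  ∃ k i, (∀ j < k, ¬ (run t prop σ H j).coinRevealed t r) ∧
    ((run t prop σ H k).loc i).pc = .waitCoin ∧ ((run t prop σ H k).loc i).round = r ∧
    ((run t prop σ H k).loc i).est = some true

lemma Favored.congr (ht : 3 * t < n) {r : ℕ} (hr : 1 ≤ r)
    (hH : ∀ x, (∀ s ≥ r, x ≠ .thresholdSig (.coin s)) → H x = H' x)
    (h : Favored t prop σ r H) : Favored t prop σ r H' := by
  obtain ⟨k, i, hk, h⟩ := h
  have heq : ∀ j ≤ k, run t prop σ H j = run t prop σ H' j := fun j hj =>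
    congrArg Prod.fst (trace_congr ht hr hH fun l hl => hk l (hl.trans_le hj))
  refine ⟨k, i, fun j hj => ?_, ?_⟩
  · rw [← heq j hj.le]; exact hk j hj
  · rw [← heq k le_rfl]; exact h

/-- The value favored in round `r` only depends on hashes other than the coins of rounds from `r`
on. -/
lemma favored_congr (ht : 3 * t < n) {r : ℕ} (hr : 1 ≤ r)
    (hH : ∀ x, (∀ s ≥ r, x ≠ .thresholdSig (.coin s)) → H x = H' x) :
    Favored t prop σ r H ↔ Favored t prop σ r H' :=
  ⟨Favored.congr ht hr hH, Favored.congr ht hr fun x hx => (hH x hx).symm⟩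

/-! ### Lucky rounds -/

/-- Until the coin of round `r` is revealed, no process gets past it. -/
lemma steps_le_of_not_revealed (ht : 3 * t < n) {r : ℕ} (hr : 1 ≤ r) {k : ℕ}
    (hk : ∀ j < k, ¬ (run t prop σ H j).coinRevealed t r) (i : Fin n) :
    ((run t prop σ H k).loc i).steps ≤ 5 * r := by
  induction k with
  | zero => exact Nat.zero_le _
  | succ k ih =>
    have hC := run_inv (prop := prop) (σ := σ) (H := H) ht k
    have ih := ih fun j hj => hk j (hj.trans (Nat.lt_succ_self k))
    rcases (run_transition (prop := prop) (σ := σ) (H := H) k).eq_or_step hC i with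
      h | ⟨h, m, hm, -⟩
    · rw [h]; exact ih
    · by_contra hlt
      have hs : ((run t prop σ H k).loc i).steps = 5 * r := by omega
      have h1 := (hC.loc i).round_pos
      have h0 := (hC.loc i).round_zero
      have hpc : ((run t prop σ H k).loc i).pc = .waitCoin ∧
          ((run t prop σ H k).loc i).round = r := by
        rcases hpc : ((run t prop σ H k).loc i).pc <;>
          simp [Local.steps, Local.afterVote, hpc] at hs h1 h0 ⊢ <;> omega
      refine hk k (Nat.lt_succ_self k) (hC.coinRevealed_of_coins (i := i) ?_)
      rw [← hpc.2]
      generalize hs' : (run t prop σ H (k + 1)).loc i = s' at hm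
      cases hm with
      | toss h hq => exact hq
      | _ h => rw [hpc.1] at h; cases h

lemma MainStep.est_eq_of_steps {c : ℕ → Bool} {i : Fin n} {v : Bool} {s s' : Local n}
    {m : Option (Msg n)} (h : MainStep t c i v s s' m) (hs : LocalInv t c s) {r : ℕ} (hr : 1 ≤ r) :
    (s.steps = 5 * r → s'.est = s.est) ∧
      (s.steps = 5 * r + 1 → s'.est = some (s.est.getD (c r))) := by
  have h0 := hs.round_zero
  have h1 := hs.round_pos
  cases h with
  | finish h b hb =>
    have hr1 : 1 ≤ s.round := h1 (Or.inr (Or.inr (Or.inr h)))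
    simp only [Local.steps, h]
    refine ⟨fun h => by omega, fun h2 => ?_⟩
    obtain rfl : s.round = r := by omega
    rw [hs.knows, if_pos (by simp [Local.known, h, hr])] at hb
    rw [Option.some.inj hb]
  | _ h =>
    simp only [Local.steps, Local.afterVote, h, reduceCtorEq, or_false, or_true, or_self,
      false_imp_iff, forall_const] at h0 h1 ⊢
    constructor <;> intros <;> first | trivial | rfl | omega

lemma MainStep.vote_of_steps {c : ℕ → Bool} {i : Fin n} {v : Bool} {s s' : Local n}
    {m : Option (Msg n)} (h : MainStep t c i v s s' m) (hs : LocalInv t c s) {q : ℕ} (hq : 1 ≤ q)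
    (h2 : s.steps = 5 * q - 2) : s.known + 1 = q ∧ n - t ≤ (roundSigners s.auxValues q).card := by
  have h0 := hs.round_zero
  have h1 := hs.round_pos
  cases h with
  | vote h hv =>
    have hr1 : 1 ≤ s.round := h1 (Or.inl h)
    simp only [Local.steps, h] at h2
    obtain rfl : s.round = q := by omega
    refine ⟨?_, hv⟩
    simp only [Local.known, h]
    omega
  | _ h =>
    simp only [Local.steps, Local.afterVote, h, reduceCtorEq, or_false, or_true, or_self,
      false_imp_iff, forall_const] at h0 h1 h2
    omega

lemma MainStep.decision_ne_none {c : ℕ → Bool} {i : Fin n} {v : Bool} {s s' : Local n}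
    {m : Option (Msg n)} (h : MainStep t c i v s s' m) (hd : s.decision ≠ none) :
    s'.decision ≠ none := by
  cases h <;> try exact hd
  simp only [hd, false_and, if_false]
  exact hd

lemma MainStep.decision_of_quorum {c : ℕ → Bool} {i : Fin n} {v : Bool} {s s' : Local n}
    {m : Option (Msg n)} (h : MainStep t c i v s s' m) (hs : LocalInv t c s) {q : ℕ}
    (h2 : s.steps = 5 * q + 1) (hq : 1 ≤ q) (hA : n - t ≤ (auxSigners s.auxValues q (c q)).card) :
    s'.decision ≠ none := by
  have h0 := hs.round_zero
  have h1 := hs.round_pos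
  cases h with
  | finish h b hb =>
    have hr1 : 1 ≤ s.round := h1 (Or.inr (Or.inr (Or.inr h)))
    simp only [Local.steps, h] at h2
    obtain rfl : s.round = q := by omega
    rw [hs.knows, if_pos (by simp [Local.known, h, hq])] at hb
    obtain rfl := Option.some.inj hb
    simp only [hA, and_true]
    split_ifs with hd
    · simp
    · exact hd
  | _ h =>
    simp only [Local.steps, Local.afterVote, h, reduceCtorEq, or_false, or_true, or_self,
      false_imp_iff, forall_const] at h0 h1 h2 <;> omega

lemma receive_est (m : Msg n) (s : Local n) : (receive m s).est = s.est := by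
  cases m <;> rfl

lemma handleStep_est (a : SignedAux n) (P Q : Finset (SignedAux n)) (s : Local n) :
    (handleStep t a P Q s).est = s.est := by
  unfold handleStep; split_ifs <;> rfl

lemma receive_decision (m : Msg n) (s : Local n) : (receive m s).decision = s.decision := by
  cases m <;> rfl

lemma handleStep_decision (a : SignedAux n) (P Q : Finset (SignedAux n)) (s : Local n) :
    (handleStep t a P Q s).decision = s.decision := by
  unfold handleStep; split_ifs <;> rfl

/-- A process that waits for the coin of round `r` without an estimate opposite to this coin
signs the value of the coin in the next round. -/
lemma signed_next_eq_coin (ht : 3 * t < n) {r : ℕ} (hr : 1 ≤ r) {i : Fin n} {k : ℕ}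
    (hk : ((run t prop σ H k).loc i).steps = 5 * r)
    (hest : ((run t prop σ H k).loc i).est ≠ some (!coinOf H r)) {l : ℕ} (hl : k ≤ l) {v : Bool}
    (hv : ⟨i, .aux (r + 1) v⟩ ∈ (run t prop σ H l).signed) : v = coinOf H r := by
  suffices h : (((run t prop σ H l).loc i).steps ≤ 5 * r + 1 →
      ((run t prop σ H l).loc i).est ≠ some (!coinOf H r)) ∧
      (((run t prop σ H l).loc i).steps = 5 * r + 2 →
        ((run t prop σ H l).loc i).est = some (coinOf H r)) ∧
      ∀ v, ⟨i, .aux (r + 1) v⟩ ∈ (run t prop σ H l).signed → v = coinOf H r from h.2.2 v hv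
  clear hv v
  have hinv := fun l => run_inv (prop := prop) (σ := σ) (H := H) ht l
  have hstep : auxStep (r + 1) = 5 * r + 3 := by
    rw [auxStep_of_ne (by omega)]; omega
  induction l, hl using Nat.le_induction with
  | base =>
    refine ⟨fun _ => hest, fun h => by omega, fun v hv => ?_⟩
    have := ((hinv k).signed_aux i (r + 1) v hv).1
    omega
  | succ l hl ih =>
    have htr := run_transition (prop := prop) (σ := σ) (H := H) (t := t) l
    have hge : 5 * r ≤ ((run t prop σ H l).loc i).steps := hk ▸ run_steps_mono ht i hl
    obtain ⟨ih1, ih2, ih3⟩ := ih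
    refine ⟨?_, ?_, fun v hv => ?_⟩
    · rcases htr.loc_cases i with h | ⟨m, h⟩ | ⟨m, -, h⟩ | ⟨a, P, Q, h⟩
      · rw [h]; exact ih1
      · rw [h.steps_eq ((hinv l).loc i)]
        intro hle
        rw [(h.est_eq_of_steps ((hinv l).loc i) hr).1 (by omega)]
        exact ih1 (by omega)
      · rw [h, receive_steps, receive_est]; exact ih1
      · rw [h, handleStep_steps, handleStep_est]; exact ih1
    · rcases htr.loc_cases i with h | ⟨m, h⟩ | ⟨m, -, h⟩ | ⟨a, P, Q, h⟩
      · rw [h]; exact ih2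
      · rw [h.steps_eq ((hinv l).loc i)]
        intro heq
        rw [(h.est_eq_of_steps ((hinv l).loc i) hr).2 (by omega)]
        have := ih1 (by omega)
        cases he : ((run t prop σ H l).loc i).est with
        | none => rfl
        | some e =>
          rw [he] at this
          simp only [Option.getD_some, Option.some.injEq, ne_eq] at this ⊢
          revert this
          cases e <;> cases coinOf H r <;> simp
      · rw [h, receive_steps, receive_est]; exact ih2
      · rw [h, handleStep_steps, handleStep_est]; exact ih2
    · rcases htr.signed_aux_cases (hinv l) ht hv with hv | ⟨P, hm⟩
      · exact ih3 v hv
      · obtain ⟨-, h1, -, h2, -⟩ := hm.aux_message ((hinv l).loc i) ht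
        simp only at h1 h2
        have h3 := ih2 (by omega)
        rw [h2 (by omega)] at h3
        exact Option.some.inj h3

/-- If the coin of round `r` falls on the favored value, the other value gets no quorum in the
next round. -/
lemma card_auxAvailable_lt_of_favored (ht : 3 * t < n) {r : ℕ} (hr : 1 ≤ r)
    (hfav : coinOf H r = true ↔ Favored t prop σ r H)
    (hrev : ∃ k, (run t prop σ H k).coinRevealed t r) (k : ℕ) :
    ((run t prop σ H k).auxAvailable (r + 1) (!coinOf H r)).card < n - t := by
  classical
  by_contra! hge
  have hinv := fun l => run_inv (prop := prop) (σ := σ) (H := H) ht l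
  -- `T` is the time at which the coin of round `r` is revealed.
  obtain ⟨T, hT, hmin⟩ : ∃ T, (run t prop σ H T).coinRevealed t r ∧
      ∀ j < T, ¬ (run t prop σ H j).coinRevealed t r :=
    ⟨Nat.find hrev, Nat.find_spec hrev, fun j hj => Nat.find_min hrev hj⟩
  have hT' : n - t ≤ (Finset.univ.filter fun i : Fin n =>
      (run t prop σ H T).available ⟨i, .coin r⟩).card := hT
  obtain ⟨i, hi1, hi2, hiF⟩ := exists_common_of_card
    (S := Finset.univ.filter fun i : Fin n => (run t prop σ H T).available ⟨i, .coin r⟩)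
    (T := (run t prop σ H (max k T)).auxAvailable (r + 1) (!coinOf H r))
    (F := (run t prop σ H (max k T)).faulty) (t := t)
    (by
      have h1 := hge.trans (Finset.card_le_card
        (run_auxAvailable_mono (r + 1) (!coinOf H r) (le_max_left k T)))
      simp only at h1
      omega) (hinv _).card_faulty
  have hsig : ⟨i, .coin r⟩ ∈ (run t prop σ H T).signed :=
    (Finset.mem_filter.1 hi1).2.resolve_left fun h => hiF (run_faulty_mono (le_max_right k T) h)
  have hsteps : ((run t prop σ H T).loc i).steps = 5 * r :=
    le_antisymm (steps_le_of_not_revealed ht hr hmin i) ((hinv T).signed_coin i r hsig).2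
  have hpc : ((run t prop σ H T).loc i).pc = .waitCoin ∧
      ((run t prop σ H T).loc i).round = r := by
    have h1 := ((hinv T).loc i).round_pos
    have h0 := ((hinv T).loc i).round_zero
    rcases hpc : ((run t prop σ H T).loc i).pc <;>
      simp [Local.steps, Local.afterVote, hpc] at hsteps h1 h0 ⊢ <;> omega
  have hest : ((run t prop σ H T).loc i).est ≠ some (!coinOf H r) := by
    intro he
    cases hc : coinOf H r with
    | false =>
      rw [hc] at he
      have := hfav.2 ⟨T, i, hmin, hpc.1, hpc.2, he⟩
      rw [hc] at this
      cases this
    | true =>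
      obtain ⟨l, j, -, hj1, hj2, hj3⟩ := hfav.1 hc
      rw [hc] at he
      -- Both values would have a quorum in round `r`.
      have h1 := ((hinv T).loc i).est_quorum (Or.inr (Or.inl hpc.1)) _ he
      have h2 := ((hinv l).loc j).est_quorum (Or.inr (Or.inl hj1)) _ hj3
      rw [hpc.2] at h1
      rw [hj2] at h2
      have h3 := (hinv (max l T)).eq_of_quorum ht
        (h1.trans (Finset.card_le_card (((hinv T).auxSigners_subset i r _).trans
          (run_auxAvailable_mono r _ (le_max_right l T)))))
        (h2.trans (Finset.card_le_card (((hinv l).auxSigners_subset j r _).trans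
          (run_auxAvailable_mono r _ (le_max_left l T)))))
      cases h3
  have := signed_next_eq_coin ht hr hsteps hest (le_max_right k T)
    ((Config.mem_auxAvailable.1 hi2).resolve_left hiF)
  simp at this

/-- If a value can get no quorum in round `q` and the coins of the rounds `q` and `q + 1` fall on
the other value, every process decides at the end of round `q + 1`. -/
lemma decision_ne_none_of_card_lt (ht : 3 * t < n) {q : ℕ} (hq : 1 ≤ q) {b : Bool}
    (hb : coinOf H q = b) (hb' : coinOf H (q + 1) = b)
    (hlt : ∀ k, ((run t prop σ H k).auxAvailable q (!b)).card < n - t) (i : Fin n) (k : ℕ)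
    (hk : 5 * (q + 1) + 2 ≤ ((run t prop σ H k).loc i).steps) :
    ((run t prop σ H k).loc i).decision ≠ none := by
  suffices h : (5 * (q + 1) - 1 ≤ ((run t prop σ H k).loc i).steps →
      n - t ≤ (auxSigners ((run t prop σ H k).loc i).auxValues (q + 1) b).card) ∧
      (5 * (q + 1) + 2 ≤ ((run t prop σ H k).loc i).steps →
        ((run t prop σ H k).loc i).decision ≠ none) from h.2 hk
  clear hk
  induction k with
  | zero =>
    have : ((run t prop σ H 0).loc i).steps = 0 := rfl
    refine ⟨fun h => ?_, fun h => ?_⟩ <;> omega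
  | succ k ih =>
    have hC := run_inv (prop := prop) (σ := σ) (H := H) ht k
    have htr := run_transition (prop := prop) (σ := σ) (H := H) (t := t) k
    have hmono := Finset.card_le_card (auxSigners_mono (htr.auxValues_subset hC i) (q + 1) b)
    rcases htr.loc_cases i with h | ⟨m, h⟩ | ⟨m, -, h⟩ | ⟨a, P, Q, h⟩
    · rw [h]; exact ih
    · have hst := h.steps_eq (hC.loc i)
      refine ⟨fun h1 => ?_, fun h1 => ?_⟩
      · by_cases h2 : 5 * (q + 1) - 1 ≤ ((run t prop σ H k).loc i).steps
        · exact (ih.1 h2).trans hmono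
        · obtain ⟨hkn, hv⟩ := h.vote_of_steps (hC.loc i) (q := q + 1) (by omega) (by omega)
          refine (hv.trans (Finset.card_le_card fun j hj => ?_)).trans hmono
          obtain ⟨w, hw⟩ := mem_roundSigners.1 hj
          by_cases hwb : w = b
          · rw [hwb] at hw
            exact mem_auxSigners.2 hw
          · exfalso
            obtain rfl : w = !b := by revert hwb; cases w <;> cases b <;> simp
            have hS := (hC.loc i).supported _ hw (by simp only; omega) (by simp)
            simp only at hS
            rw [lastOpposite_succ_of_eq (by omega) (by simpa using hb), quorum,
              if_neg (by omega)] at hS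
            exact absurd (hS.trans (Finset.card_le_card (hC.auxSigners_subset i q _)))
              (not_le.2 (hlt k))
      · by_cases h2 : 5 * (q + 1) + 2 ≤ ((run t prop σ H k).loc i).steps
        · exact h.decision_ne_none (ih.2 h2)
        · exact h.decision_of_quorum (hC.loc i) (q := q + 1) (by omega) (by omega)
            (hb'.symm ▸ ih.1 (by omega))
    · rw [h, receive_steps, receive_auxValues, receive_decision]; exact ih
    · refine ⟨fun h1 => (ih.1 ?_).trans hmono, ?_⟩
      · rwa [h, handleStep_steps] at h1
      · rw [h, handleStep_steps, handleStep_decision]; exact ih.2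

/-- Every process decides if in three consecutive rounds the coin falls on the value favored in
the first of them. -/
theorem termination_of_favored (ht : 3 * t < n) {r : ℕ} (hr : 1 ≤ r)
    (hfav : coinOf H r = true ↔ Favored t prop σ r H) (h1 : coinOf H (r + 1) = coinOf H r)
    (h2 : coinOf H (r + 2) = coinOf H r) (hF : FiniteDelays t prop H (run t prop σ H)) :
    Termination (run t prop σ H) := by
  intro i hi
  have hrev : ∃ k, (run t prop σ H k).coinRevealed t r := by
    obtain ⟨k, hk⟩ := exists_le_steps ht hF (5 * r + 1) i hi
    exact ⟨k, (run_inv ht k).coinRevealed_of_lt_steps hr hk⟩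
  obtain ⟨k, hk⟩ := exists_le_steps ht hF (5 * (r + 1 + 1) + 2) i hi
  obtain ⟨b, hb⟩ := Option.ne_none_iff_exists'.1 (decision_ne_none_of_card_lt ht (by omega) h1 h2
    (card_auxAvailable_lt_of_favored ht hr hfav hrev) i k hk)
  exact ⟨b, k, hb⟩

end Run

/-! ### Measurability -/

/-- The function looks at the hash function only on some fixed finite set of inputs. -/
def FinitelyDetermined {α : Type*} (f : Oracle ℓ → α) : Prop :=
  ∃ S : Finset OracleInput, DependsOn f (S : Set OracleInput)

/-- The oracle with the values `z` on `S` and a default value elsewhere. -/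
def extendOracle (S : Finset OracleInput) (z : S → Hash ℓ) : Oracle ℓ := fun x =>
  if h : x ∈ S then z ⟨x, h⟩ else fun _ => false

lemma FinitelyDetermined.exists_factor {α : Type*} {f : Oracle ℓ → α}
    (hf : FinitelyDetermined f) :
    ∃ S : Finset OracleInput, ∀ H, f H = f (extendOracle S fun x => H x) := by
  obtain ⟨S, hS⟩ := hf
  refine ⟨S, fun H => hS fun x hx => ?_⟩
  rw [extendOracle, dif_pos (Finset.mem_coe.1 hx)]

lemma FinitelyDetermined.finite_range {α : Type*} {f : Oracle ℓ → α}
    (hf : FinitelyDetermined f) : (Set.range f).Finite := by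
  obtain ⟨S, hS⟩ := hf.exists_factor
  refine (Set.finite_range fun z : S → Hash ℓ => f (extendOracle S z)).subset ?_
  rintro _ ⟨H, rfl⟩
  exact ⟨fun x => H x, (hS H).symm⟩

lemma FinitelyDetermined.measurableSet {α : Type*} {f : Oracle ℓ → α}
    (hf : FinitelyDetermined f) (p : α → Prop) : MeasurableSet {H | p (f H)} := by
  obtain ⟨S, hS⟩ := hf.exists_factor
  have h1 : MeasurableSet {z : S → Hash ℓ | p (f (extendOracle S z))} :=
    (Set.toFinite _).measurableSet
  have h2 : Measurable fun (H : Oracle ℓ) (x : S) => H x := by fun_prop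
  convert h2 h1 using 1
  ext H
  simp only [Set.mem_ofPred_eq, Set.mem_preimage]
  rw [hS H]

lemma FinitelyDetermined.bind {α β : Type*} {f : Oracle ℓ → α} {g : α → Oracle ℓ → β}
    (hf : FinitelyDetermined f) (hg : ∀ y, FinitelyDetermined (g y)) :
    FinitelyDetermined fun H => g (f H) H := by
  have hfin := hf.finite_range
  obtain ⟨S, hS⟩ := hf
  choose T hT using hg
  refine ⟨S ∪ hfin.toFinset.biUnion T, fun H H' h => ?_⟩
  have h1 : f H = f H' := hS fun x hx => h x (by simp [Finset.mem_coe.1 hx])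
  simp only
  rw [← h1]
  refine hT (f H) fun x hx => h x ?_
  simp only [Finset.coe_union, Set.mem_union, Finset.mem_coe, Finset.mem_biUnion,
    Set.Finite.mem_toFinset]
  exact Or.inr ⟨f H, ⟨H, rfl⟩, hx⟩

lemma finitelyDetermined_execute (prop : Fin n → Bool) (C : Config n ℓ) (e : Action n) :
    FinitelyDetermined fun H => execute t prop H C e := by
  cases e with
  | step i P =>
    refine ⟨{.thresholdSig (.coin (C.loc i).round)}, fun H H' h => ?_⟩
    simp only [execute]
    rw [mainStep_congr (H' := H') fun _ => ?_]
    rw [coinOf, coinOf, h _ (by simp)]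
  | query x =>
    refine ⟨{x}, fun H H' h => ?_⟩
    simp only [execute]
    rw [h x (by simp)]
  | _ => exact ⟨∅, fun H H' _ => rfl⟩

lemma finitelyDetermined_trace (prop : Fin n → Bool) (σ : Adversary n ℓ) (k : ℕ) :
    FinitelyDetermined fun H => trace t prop σ H k := by
  induction k with
  | zero => exact ⟨∅, fun _ _ _ => rfl⟩
  | succ k ih =>
    refine ih.bind (g := fun p H => (execute t prop H p.1 (σ (p.1 :: p.2)), p.1 :: p.2))
      fun p => ?_
    obtain ⟨S, hS⟩ := finitelyDetermined_execute (t := t) prop p.1 (σ (p.1 :: p.2))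
    exact ⟨S, fun H H' h => Prod.ext (hS h) rfl⟩

lemma measurableSet_run (prop : Fin n → Bool) (σ : Adversary n ℓ) (k : ℕ)
    (p : Config n ℓ → Prop) : MeasurableSet {H | p (run t prop σ H k)} :=
  (finitelyDetermined_trace prop σ k).measurableSet fun y => p y.1

lemma measurableSet_favored (prop : Fin n → Bool) (σ : Adversary n ℓ) (r : ℕ) :
    MeasurableSet {H | Favored t prop σ r H} := by
  have : {H | Favored t prop σ r H} = ⋃ k, ⋃ i,
      (⋂ j, ⋂ (_ : j < k), {H | ¬ (run t prop σ H j).coinRevealed t r}) ∩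
      {H | ((run t prop σ H k).loc i).pc = .waitCoin ∧
        ((run t prop σ H k).loc i).round = r ∧ ((run t prop σ H k).loc i).est = some true} := by
    ext H
    simp only [Favored, Set.mem_ofPred_eq, Set.mem_iUnion, Set.mem_inter_iff, Set.mem_iInter]
  rw [this]
  refine .iUnion fun k => .iUnion fun i => .inter (.iInter fun j => .iInter fun _ => ?_) ?_
  · exact measurableSet_run prop σ j fun C => ¬ C.coinRevealed t r
  · exact measurableSet_run prop σ k fun C => (C.loc i).pc = .waitCoin ∧
      (C.loc i).round = r ∧ (C.loc i).est = some true

/-! ### Independence of the coins -/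

/-- Measurable sets of a product space that depend on disjoint sets of coordinates are
independent. -/
lemma infinitePi_inter_of_dependsOn {ι : Type*} {X : ι → Type*} [∀ i, MeasurableSpace (X i)]
    (μ : ∀ i, Measure (X i)) [∀ i, IsProbabilityMeasure (μ i)] {S T : Set ι} (hST : Disjoint S T)
    {A B : Set (∀ i, X i)} (hA : MeasurableSet A) (hB : MeasurableSet B)
    (hAS : DependsOn (fun x => x ∈ A) S) (hBT : DependsOn (fun x => x ∈ B) T) :
    Measure.infinitePi μ (A ∩ B) = Measure.infinitePi μ A * Measure.infinitePi μ B := by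
  classical
  have hne : ∀ i, Nonempty (X i) := fun i => (μ i).nonempty_of_neZero
  have key : ∀ {S : Set ι} {A : Set (∀ i, X i)}, MeasurableSet A →
      DependsOn (fun x => x ∈ A) S →
      MeasurableSet[⨆ i ∈ S, MeasurableSpace.comap (fun x : ∀ i, X i => x i) inferInstance] A := by
    intro S A hA hAS
    -- Overwriting the coordinates outside of `S` does not change membership in `A`.
    let ρ : (∀ i, X i) → ∀ i, X i := fun x i => if i ∈ S then x i else (hne i).some
    have hρ : Measurable[⨆ i ∈ S,
        MeasurableSpace.comap (fun x : ∀ i, X i => x i) inferInstance] ρ := by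
      refine @measurable_pi_lambda _ _ _ (_) _ _ fun i => ?_
      by_cases hi : i ∈ S
      · simp only [ρ, if_pos hi]
        exact Measurable.mono (comap_measurable _) (le_iSup₂_of_le i hi le_rfl) le_rfl
      · simp only [ρ, if_neg hi]
        exact @measurable_const _ _ _ (_) _
    have heq : A = ρ ⁻¹' A := by
      ext x
      refine iff_of_eq (hAS fun i hi => ?_)
      simp [ρ, hi]
    rw [heq]
    exact hρ hA
  have hind := ProbabilityTheory.iIndepFun_infinitePi (P := μ) (X := fun i (x : X i) => x)
    fun i => measurable_id
  rw [ProbabilityTheory.iIndepFun_iff_iIndep] at hind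
  have := ProbabilityTheory.indep_iSup_of_disjoint
    (fun i => (measurable_pi_apply i).comap_le) hind hST
  exact (ProbabilityTheory.Indep_iff _ _ _).1 this A B (key hA hAS) (key hB hBT)

instance (ℓ : ℕ) : IsProbabilityMeasure (oracleLaw ℓ) := by
  unfold oracleLaw; infer_instance

/-- The inputs of the hash function that give the coins of the rounds from `r` on. -/
def coinInputs (r : ℕ) : Set OracleInput := {x | ∃ s ≥ r, x = .thresholdSig (.coin s)}

/-- The hashes for the coins of the rounds `r`, `r + 1` and `r + 2` are constantly `b`. -/
def constantCoins (ℓ : ℕ) (r : ℕ) (b : Bool) : Set (Oracle ℓ) :=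
  Set.pi ({.thresholdSig (.coin r), .thresholdSig (.coin (r + 1)),
    .thresholdSig (.coin (r + 2))} : Finset OracleInput) fun _ => {fun _ => b}

lemma measurableSet_constantCoins (r : ℕ) (b : Bool) : MeasurableSet (constantCoins ℓ r b) :=
  .pi (Finset.countable_toSet _) fun _ _ => measurableSet_singleton _

lemma oracleLaw_constantCoins (r : ℕ) (b : Bool) :
    oracleLaw ℓ (constantCoins ℓ r b) = ((Fintype.card (Hash ℓ) : ENNReal)⁻¹) ^ 3 := by
  rw [oracleLaw, constantCoins, Measure.infinitePi_pi _ fun _ _ => measurableSet_singleton _]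
  simp only [PMF.toMeasure_apply_singleton _ _ (measurableSet_singleton _),
    PMF.uniformOfFintype_apply, Finset.prod_const]
  congr 1
  rw [Finset.card_eq_three]
  exact ⟨_, _, _, by simp, by simp, by simp, rfl⟩

lemma dependsOn_constantCoins (r : ℕ) (b : Bool) :
    DependsOn (fun H => H ∈ constantCoins ℓ r b) (coinInputs r) := by
  intro H H' h
  have h0 := h (.thresholdSig (.coin r)) ⟨r, le_rfl, rfl⟩
  have h1 := h (.thresholdSig (.coin (r + 1))) ⟨r + 1, by omega, rfl⟩
  have h2 := h (.thresholdSig (.coin (r + 2))) ⟨r + 2, by omega, rfl⟩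
  simp [constantCoins, h0, h1, h2]

/-- The coin falls on the value given by `F` (`true` on `F` and `false` elsewhere) in the three
rounds `r`, `r + 1` and `r + 2`. -/
def luckySet (F : Set (Oracle ℓ)) (r : ℕ) : Set (Oracle ℓ) :=
  {H | (coinOf H r = true ↔ H ∈ F) ∧ coinOf H (r + 1) = coinOf H r ∧
    coinOf H (r + 2) = coinOf H r}

lemma measurable_coinOf (r : ℕ) : Measurable fun H : Oracle ℓ => coinOf H r := by
  unfold coinOf; fun_prop

lemma measurableSet_luckySet {F : Set (Oracle ℓ)} (hF : MeasurableSet F) (r : ℕ) :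
    MeasurableSet (luckySet F r) := by
  have h0 := measurable_coinOf (ℓ := ℓ) r
  have h1 := measurable_coinOf (ℓ := ℓ) (r + 1)
  have h2 := measurable_coinOf (ℓ := ℓ) (r + 2)
  refine .inter (MeasurableSet.iff (h0 (measurableSet_singleton true)) hF)
    (.inter (measurableSet_eq_fun h1 h0) (measurableSet_eq_fun h2 h0))

lemma dependsOn_luckySet {F : Set (Oracle ℓ)} {r q : ℕ} (hrq : r + 3 ≤ q)
    (hF : DependsOn (fun H => H ∈ F) (coinInputs r)ᶜ) :
    DependsOn (fun H => H ∈ luckySet F r) (coinInputs q)ᶜ := by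
  intro H H' h
  have hc : ∀ s < q, coinOf H s = coinOf H' s := fun s hs => by
    unfold coinOf
    rw [h]
    rintro ⟨s', hs', heq⟩
    simp at heq
    omega
  have hF' : (H ∈ F) = (H' ∈ F) := hF fun x hx => h x fun ⟨s, hs, heq⟩ =>
    hx ⟨s, by omega, heq⟩
  simp only [luckySet, Set.mem_ofPred_eq]
  rw [hc r (by omega), hc (r + 1) (by omega), hc (r + 2) (by omega), hF']

/-- Whatever happened before, independently of the coins from round `r` on, the three coins have
at least a fixed probability of falling on the given value. -/
lemma oracleLaw_inter_luckySet_ge {F A : Set (Oracle ℓ)} {r : ℕ} (hF : MeasurableSet F)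
    (hFd : DependsOn (fun H => H ∈ F) (coinInputs r)ᶜ) (hA : MeasurableSet A)
    (hAd : DependsOn (fun H => H ∈ A) (coinInputs r)ᶜ) :
    oracleLaw ℓ A * ((Fintype.card (Hash ℓ) : ENNReal)⁻¹) ^ 3 ≤
      oracleLaw ℓ (A ∩ luckySet F r) := by
  have hdisj : Disjoint (coinInputs r)ᶜ (coinInputs r) := disjoint_compl_left
  have h1 : oracleLaw ℓ ((A ∩ F) ∩ constantCoins ℓ r true) = oracleLaw ℓ (A ∩ F) * _ :=
    infinitePi_inter_of_dependsOn _ hdisj (hA.inter hF) (measurableSet_constantCoins r true)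
      (fun x y h => propext (and_congr (iff_of_eq (hAd h)) (iff_of_eq (hFd h))))
      (dependsOn_constantCoins r true)
  have h2 : oracleLaw ℓ ((A \ F) ∩ constantCoins ℓ r false) = oracleLaw ℓ (A \ F) * _ :=
    infinitePi_inter_of_dependsOn _ hdisj (hA.diff hF) (measurableSet_constantCoins r false)
      (fun x y h => propext (and_congr (iff_of_eq (hAd h)) (not_congr (iff_of_eq (hFd h)))))
      (dependsOn_constantCoins r false)
  change _ = _ * oracleLaw ℓ _ at h1
  change _ = _ * oracleLaw ℓ _ at h2
  rw [oracleLaw_constantCoins] at h1 h2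
  rw [← measure_inter_add_sdiff A hF, add_mul, ← h1, ← h2, ← measure_union _
    ((hA.diff hF).inter (measurableSet_constantCoins r false))]
  · refine measure_mono ?_
    rintro H (⟨⟨hHA, hHF⟩, hc⟩ | ⟨⟨hHA, hHF⟩, hc⟩) <;> refine ⟨hHA, ?_⟩ <;>
      simp [constantCoins] at hc <;> simp [luckySet, coinOf, hc, hHF]
  · exact Set.disjoint_left.2 fun H h h' => h'.1.2 h.1.2

/-- Let a value be given for every round that only depends on the hashes other than the coins from
this round on. Almost surely the coins fall on this value in some round and in the next two. -/
theorem ae_exists_luckySet (F : ℕ → Set (Oracle ℓ)) (hF : ∀ r, MeasurableSet (F r))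
    (hd : ∀ r, 1 ≤ r → DependsOn (fun H => H ∈ F r) (coinInputs r)ᶜ) :
    ∀ᵐ H ∂oracleLaw ℓ, ∃ r, 1 ≤ r ∧ H ∈ luckySet (F r) r := by
  set p : ENNReal := ((Fintype.card (Hash ℓ) : ENNReal)⁻¹) ^ 3 with hp
  have hp0 : p ≠ 0 := by simp [hp]
  have hp1 : p ≤ 1 := pow_le_one₀ zero_le (ENNReal.inv_le_one.2 (by
    exact_mod_cast Fintype.card_pos))
  -- The rounds `1, 4, 7, …` use disjoint triples of coins.
  let bad : ℕ → Set (Oracle ℓ) := fun M =>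
    ⋂ m, ⋂ (_ : m < M), (luckySet (F (3 * m + 1)) (3 * m + 1))ᶜ
  have hbad : ∀ M, MeasurableSet (bad M) := fun M => .iInter fun m => .iInter fun _ =>
    (measurableSet_luckySet (hF _) _).compl
  have hbadd : ∀ M, DependsOn (fun H => H ∈ bad M) (coinInputs (3 * M + 1))ᶜ := by
    intro M H H' h
    simp only [bad, Set.mem_iInter, Set.mem_compl_iff, eq_iff_iff]
    refine forall₂_congr fun m hm => not_congr (iff_of_eq ?_)
    exact dependsOn_luckySet (by omega) (hd _ (by omega)) h
  have hsucc : ∀ M, bad (M + 1) = bad M \ luckySet (F (3 * M + 1)) (3 * M + 1) := by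
    intro M
    ext H
    simp only [bad, Set.mem_iInter, Set.mem_sdiff, Set.mem_compl_iff, Nat.lt_succ_iff_lt_or_eq]
    exact ⟨fun h => ⟨fun m hm => h m (Or.inl hm), h M (Or.inr rfl)⟩, fun h m hm => by
      rcases hm with hm | rfl
      · exact h.1 m hm
      · exact h.2⟩
  have hle : ∀ M, oracleLaw ℓ (bad M) ≤ (1 - p) ^ M := by
    intro M
    induction M with
    | zero => simpa using prob_le_one
    | succ M ih =>
      have h1 := oracleLaw_inter_luckySet_ge (hF (3 * M + 1)) (hd _ (by omega)) (hbad M) (hbadd M)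
      have h2 := measure_inter_add_sdiff (μ := oracleLaw ℓ) (bad M)
        (measurableSet_luckySet (hF (3 * M + 1)) (3 * M + 1))
      rw [← hsucc] at h2
      calc oracleLaw ℓ (bad (M + 1))
          ≤ oracleLaw ℓ (bad M) - oracleLaw ℓ (bad M) * p := by
            refine ENNReal.le_sub_of_add_le_left
              (ENNReal.mul_ne_top (measure_ne_top _ _) (hp1.trans_lt ENNReal.one_lt_top).ne) ?_
            rw [← h2]
            gcongr
            rwa [h2]
        _ = oracleLaw ℓ (bad M) * (1 - p) := by
            rw [ENNReal.mul_sub fun _ _ => measure_ne_top _ _, mul_one]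
        _ ≤ (1 - p) ^ (M + 1) := by
            rw [pow_succ]
            gcongr
  have hlim : Filter.Tendsto (fun M : ℕ => (1 - p) ^ M) Filter.atTop (nhds 0) :=
    ENNReal.tendsto_pow_atTop_nhds_zero_of_lt_one
      (ENNReal.sub_lt_self ENNReal.one_ne_top one_ne_zero hp0)
  rw [ae_iff]
  refine le_antisymm (ge_of_tendsto' hlim fun M => (measure_mono ?_).trans (hle M)) zero_le
  intro H hH
  simp only [Set.mem_ofPred_eq, not_exists, not_and] at hH
  simp only [bad, Set.mem_iInter]
  exact fun m _ => hH (3 * m + 1) (by omega)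

end BBC

theorem theorem1 (n t ℓ : ℕ) (ht : 3 * t < n) (prop : Fin n → Bool)
    (σ : BBC.Adversary n ℓ) :
    (∀ H : BBC.Oracle ℓ,
      BBC.Agreement (BBC.run t prop σ H) ∧ BBC.Validity prop (BBC.run t prop σ H)) ∧
    (∀ᵐ H ∂BBC.oracleLaw ℓ,
      BBC.FiniteDelays t prop H (BBC.run t prop σ H) →
        BBC.Termination (BBC.run t prop σ H)) := by
  refine ⟨fun H => ⟨BBC.agreement_run ht, BBC.validity_run ht⟩, ?_⟩
  have hlucky := BBC.ae_exists_luckySet (fun r => {H | BBC.Favored t prop σ r H})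
    (fun r => BBC.measurableSet_favored prop σ r)
    fun r hr H H' h => propext (BBC.favored_congr ht hr fun x hx =>
      h x fun ⟨s, hs, heq⟩ => hx s hs heq)
  filter_upwards [hlucky] with H ⟨r, hr, hfav, h1, h2⟩ hF
  exact BBC.termination_of_favored ht hr hfav h1 h2 hF
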